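/- **Definitions.** A *selfadjoint operator space* is a norm-closed subspace $E\subseteq\mathcal B(H)$ ($H$ a complex Hilbert space) with $E^*=E$. For each $n\in\mathbb N$, $M_n(E)\subseteq M_n(\mathcal B(H))=\mathcal B(H^n)$ carries the induced norm and involution and the induced cone $M_n(E)_+=M_n(E)\cap\mathcal B(H^n)_+$; $M_n(E)_{sa}$ denotes its selfadjoint elements. For a linear map $\theta\colon E\to F$ put $\theta^{(n)}([x_{ij}])=[\theta(x_{ij})]$. The map $\theta$ is *completely isometric* if every $\theta^{(n)}$ is isometric; it is *completely positive* if $\theta(x^*)=\theta(x)^*$ for all $x\in E$ and $\theta^{(n)}(M_n(E)_+)\subseteq M_n(F)_+$ for all $n$; and it is a *complete order embedding* if it is completely positive and invertible onto its image with completely positive inverse. A functional $\varphi\colon M_n(E)\to\mathbb C$ is *contractive positive* if it is linear, $|\varphi(x)|\le\|x\|$ and $\varphi(x^*)=\overline{\varphi(x)}$ for all $x\in M_n(E)$, and $\varphi\ge 0$ on $M_n(E)_+$. *Werner's unitisation* of $E$ is $E^\#=E\oplus\mathbb C$ with involution $(x,a)^*=(x^*,\bar a)$, unit $(0,1)$ and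 the matrix cones defined as follows: a selfadjoint $(x,a)\in M_n(E^\#)=M_n(E)\oplus M_n(\mathbb C)$ lies in $M_n(E^\#)_+$ if and only if $a\ge 0$ and $$\varphi\big((a+\varepsilon I_n)^{-1/2}\,x\,(a+\varepsilon I_n)^{-1/2}\big)\ge -1$$ for all $\varepsilon>0$ and all contractive positive functionals $\varphi$ on $M_n(E)$. For $X\in M_n(E^\#)$, with $1_n$ the diagonal matrix with diagonal entries $(0,1)$, the order unit norm is $$\|X\|_\#^{(n)}=\inf\Big\{t\ge 0:\begin{bmatrix} t\,1_n & X\\ X^* & t\,1_n\end{bmatrix}\in M_{2n}(E^\#)_+\Big\}.$$ For linear $\theta\colon E\to F$ let $\theta^\#\colon E^\#\to F^\#$, $\theta^\#(x,a)=(\theta(x),a)$. Complete positivity, complete order embeddings and completely isometric maps between unitisations are defined with respect to these matrix cones and norms. A completely isometric complete order embedding $\theta$ is an *embedding* if $\theta^\#$ is a unital complete order embedding. It is a *gauge maximal isometry* if $$\operatorname{dist}(x,M_n(E)_+)=\operatorname{dist}(\theta^{(n)}(x),M_n(F)_+)\quad\text{for all } n\in\mathbb N \text{ and } x\in M_n(E)_{sa}.$$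 **Theorem.** Let $\theta\colon E\to F$ be a completely isometric complete order embedding between selfadjoint operator spaces. Then the following are equivalent: 1. $\theta$ is an embedding; 2. $\theta^\#$ is completely isometric; 3. for every $n\in\mathbb N$, every contractive positive functional $\varphi$ on $M_n(E)$ extends to a contractive positive functional $\tilde\varphi$ on $M_n(F)$, that is, $\tilde\varphi\circ\theta^{(n)}=\varphi$; 4. $\theta$ is a gauge maximal isometry. -/

import Mathlib

open scoped ComplexOrder MatrixOrder

noncomputable section

/-- A (concrete) selfadjoint operator space: a norm-closed, selfadjoint linear subspace of `B(H)`
for a complex Hilbert space `H`. -/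
structure SelfadjointOperatorSpace (H : Type*) [NormedAddCommGroup H] [InnerProductSpace ℂ H]
    [CompleteSpace H] extends Submodule ℂ (H →L[ℂ] H) where
  star_mem' : ∀ x ∈ carrier, star x ∈ carrier
  isClosed' : IsClosed carrier

namespace SelfadjointOperatorSpace

section BlockOperators

/-- `B(H^ι)`, where `H^ι` is the Hilbert space direct sum of copies of `H`. -/
abbrev BlockOp (H : Type*) [NormedAddCommGroup H] [InnerProductSpace ℂ H] (ι : Type) [Fintype ι] :
    Type _ :=
  PiLp 2 (fun _ : ι => H) →L[ℂ] PiLp 2 (fun _ : ι => H)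

/-- The `j`-th coordinate inclusion `H → H^ι`, into the Hilbert space direct sum. -/
def blockIncl (H : Type*) [NormedAddCommGroup H] [InnerProductSpace ℂ H] (ι : Type) [Fintype ι]
    [DecidableEq ι] (j : ι) : H →L[ℂ] PiLp 2 (fun _ : ι => H) :=
  (PiLp.continuousLinearEquiv 2 ℂ (fun _ : ι => H)).symm.toContinuousLinearMap ∘L
    ContinuousLinearMap.single ℂ (fun _ : ι => H) j

variable {H : Type*} [NormedAddCommGroup H] [InnerProductSpace ℂ H]
variable {ι : Type} [Fintype ι] [DecidableEq ι]

/-- The `(i, j)` entry, in `B(H)`, of an operator on `H^ι`. -/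
def entry (T : BlockOp H ι) (i j : ι) : H →L[ℂ] H :=
  PiLp.proj 2 (fun _ : ι => H) i ∘L T ∘L blockIncl H ι j

/-- The operator on `H^ι` with prescribed entries; this is the identification
`M_ι(B(H)) = B(H^ι)`. -/
def ofEntries (A : ι → ι → (H →L[ℂ] H)) : BlockOp H ι :=
  ∑ i, ∑ j, blockIncl H ι i ∘L A i j ∘L PiLp.proj 2 (fun _ : ι => H) j

theorem blockIncl_apply (i j : ι) (h : H) :
    blockIncl H ι j h i = if i = j then h else 0 := by
  by_cases hij : i = j
  · subst hij
    simp [blockIncl]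
  · simp [blockIncl, hij]

theorem sum_blockIncl (v : PiLp 2 (fun _ : ι => H)) :
    ∑ j, blockIncl H ι j (v j) = v := by
  ext i
  simp [blockIncl_apply]

theorem entry_ofEntries (A : ι → ι → (H →L[ℂ] H)) (i j : ι) :
    entry (ofEntries A) i j = A i j := by
  ext h
  simp [entry, ofEntries, blockIncl_apply, apply_ite]

theorem entry_apply (T : BlockOp H ι) (i j : ι) (h : H) :
    entry T i j h = T (blockIncl H ι j h) i := rfl

theorem ofEntries_entry (T : BlockOp H ι) : ofEntries (entry T) = T := by
  ext v i
  conv_rhs => rw [← sum_blockIncl v, map_sum]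
  simp [ofEntries, blockIncl_apply, entry_apply]

theorem inner_blockIncl (j : ι) (h : H)
    (v : PiLp 2 (fun _ : ι => H)) : inner ℂ (blockIncl H ι j h) v = inner ℂ h (v j) := by
  rw [PiLp.inner_apply, Finset.sum_eq_single j]
  · simp [blockIncl_apply]
  · intro i _ hij
    simp [blockIncl_apply, hij]
  · simp

/-- The adjoint of an operator matrix is the conjugate transpose. -/
theorem entry_star [CompleteSpace H] (T : BlockOp H ι) (i j : ι) :
    entry (star T) i j = star (entry T j i) := by
  ext h
  refine ext_inner_left ℂ fun g => ?_
  have h2 : inner ℂ (T (blockIncl H ι i g)) (blockIncl H ι j h) =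
      inner ℂ (T (blockIncl H ι i g) j) h := by
    rw [← inner_conj_symm, inner_blockIncl, inner_conj_symm]
  rw [ContinuousLinearMap.star_eq_adjoint, ContinuousLinearMap.star_eq_adjoint,
    ContinuousLinearMap.adjoint_inner_right, entry_apply, entry_apply, ← inner_blockIncl,
    ContinuousLinearMap.adjoint_inner_right, h2]

end BlockOperators

variable {H : Type*} [NormedAddCommGroup H] [InnerProductSpace ℂ H] [CompleteSpace H]
variable {K : Type*} [NormedAddCommGroup K] [InnerProductSpace ℂ K] [CompleteSpace K]

instance : CoeSort (SelfadjointOperatorSpace H) (Type _) := ⟨fun E => E.toSubmodule⟩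

/-- The involution of `E`, inherited from `B(H)`. -/
instance (E : SelfadjointOperatorSpace H) : StarAddMonoid E where
  star x := ⟨star (x : H →L[ℂ] H), E.star_mem' _ x.2⟩
  star_involutive x := Subtype.ext (star_star (x : H →L[ℂ] H))
  star_add x y := Subtype.ext (star_add (x : H →L[ℂ] H) (y : H →L[ℂ] H))

/-- `M_ι(E)`: the operators on `H^ι` all of whose entries lie in `E`. It carries the norm inherited
from `B(H^ι) = M_ι(B(H))`. -/
def Mat (E : SelfadjointOperatorSpace H) (ι : Type) [Fintype ι] [DecidableEq ι] :
    Submodule ℂ (BlockOp H ι) where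
  carrier := {x | ∀ i j, entry x i j ∈ E.toSubmodule}
  add_mem' {x y} hx hy i j := by
    have h : entry (x + y) i j = entry x i j + entry y i j := by ext; simp [entry]
    rw [h]
    exact E.toSubmodule.add_mem (hx i j) (hy i j)
  zero_mem' i j := by
    have h : entry (0 : BlockOp H ι) i j = 0 := by
      ext; simp [entry]
    rw [h]
    exact E.toSubmodule.zero_mem
  smul_mem' c x hx i j := by
    have h : entry (c • x) i j = c • entry x i j := by ext; simp [entry]
    rw [h]
    exact E.toSubmodule.smul_mem c (hx i j)

instance (E : SelfadjointOperatorSpace H) (ι : Type) [Fintype ι] [DecidableEq ι] :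
    NormedAddCommGroup (E.Mat ι) := Submodule.normedAddCommGroup (E.Mat ι)

instance (E : SelfadjointOperatorSpace H) (ι : Type) [Fintype ι] [DecidableEq ι] :
    NormedSpace ℂ (E.Mat ι) := Submodule.normedSpace (E.Mat ι)

/-- The `(i, j)` entry of an element of `M_ι(E)`. -/
def Mat.coeff {E : SelfadjointOperatorSpace H} {ι : Type} [Fintype ι] [DecidableEq ι]
    (x : E.Mat ι) (i j : ι) : E :=
  ⟨entry (x : BlockOp H ι) i j, x.2 i j⟩

/-- The element of `M_ι(E)` with prescribed entries. -/
def Mat.of {E : SelfadjointOperatorSpace H} {ι : Type} [Fintype ι] [DecidableEq ι]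
    (A : ι → ι → E) : E.Mat ι :=
  ⟨ofEntries fun i j => (A i j : H →L[ℂ] H), fun i j => by
    rw [entry_ofEntries]
    exact (A i j).2⟩

/-- The involution of `M_ι(E)`: the adjoint in `B(H^ι)`, i.e. the conjugate transpose. -/
instance (E : SelfadjointOperatorSpace H) (ι : Type) [Fintype ι] [DecidableEq ι] :
    StarAddMonoid (E.Mat ι) where
  star x := ⟨star (x : BlockOp H ι), fun i j => by
    rw [entry_star]
    exact E.star_mem' _ (x.2 j i)⟩
  star_involutive x := Subtype.ext (star_star (x : BlockOp H ι))
  star_add x y := Subtype.ext (star_add (x : BlockOp H ι) (y : BlockOp H ι))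

/-- The matrix cone `M_ι(E)₊`: the elements that are positive operators on `H^ι`. -/
def posCone (E : SelfadjointOperatorSpace H) (ι : Type) [Fintype ι] [DecidableEq ι] :
    Set (E.Mat ι) :=
  {x | (x : BlockOp H ι).IsPositive}

/-- The amplification `[x_ij] ↦ [θ(x_ij)]`. -/
def amp {E : SelfadjointOperatorSpace H} {F : SelfadjointOperatorSpace K} (θ : E →ₗ[ℂ] F)
    (ι : Type) [Fintype ι] [DecidableEq ι] : E.Mat ι →ₗ[ℂ] F.Mat ι where
  toFun x := Mat.of fun i j => θ (Mat.coeff x i j)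
  map_add' x y := by
    have h : ∀ i j, Mat.coeff (x + y) i j = Mat.coeff x i j + Mat.coeff y i j := fun i j =>
      Subtype.ext (by ext; simp [Mat.coeff, entry])
    apply Subtype.ext
    simp [Mat.of, ofEntries, h, Finset.sum_add_distrib]
  map_smul' c x := by
    have h : ∀ i j, Mat.coeff (c • x) i j = c • Mat.coeff x i j := fun i j =>
      Subtype.ext (by ext; simp [Mat.coeff, entry])
    apply Subtype.ext
    simp [Mat.of, ofEntries, h, Finset.smul_sum]

/-- `‖θ^(n)(x)‖ = ‖x‖` for all `n` and all `x ∈ M_n(E)`. -/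
def IsCompletelyIsometric {E : SelfadjointOperatorSpace H} {F : SelfadjointOperatorSpace K}
    (θ : E →ₗ[ℂ] F) : Prop :=
  ∀ (n : ℕ) (x : E.Mat (Fin n)), ‖amp θ (Fin n) x‖ = ‖x‖

/-- `θ` is selfadjoint and every amplification maps the positive cone into the positive cone. -/
def IsCompletelyPositive {E : SelfadjointOperatorSpace H} {F : SelfadjointOperatorSpace K}
    (θ : E →ₗ[ℂ] F) : Prop :=
  (∀ x : E, θ (star x) = star (θ x)) ∧
    ∀ (n : ℕ), ∀ x ∈ E.posCone (Fin n), amp θ (Fin n) x ∈ F.posCone (Fin n)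

/-- `θ` is completely positive and invertible onto its image, with completely positive inverse. -/
def IsCompleteOrderEmbedding {E : SelfadjointOperatorSpace H} {F : SelfadjointOperatorSpace K}
    (θ : E →ₗ[ℂ] F) : Prop :=
  IsCompletelyPositive θ ∧ Function.Injective θ ∧
    ∀ (n : ℕ) (x : E.Mat (Fin n)), amp θ (Fin n) x ∈ F.posCone (Fin n) → x ∈ E.posCone (Fin n)

/-- `φ ∈ CCP(M_ι(E), ℂ)`: the functional `φ` is contractive and positive, where positive means
selfadjoint and nonnegative on `M_ι(E)₊`. (For functionals, contractivity and positivity are the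
same as complete contractivity and complete positivity.) -/
def IsCCP {E : SelfadjointOperatorSpace H} {ι : Type} [Fintype ι] [DecidableEq ι]
    (φ : E.Mat ι →ₗ[ℂ] ℂ) : Prop :=
  (∀ x, ‖φ x‖ ≤ ‖x‖) ∧ (∀ x, φ (star x) = star (φ x)) ∧ ∀ x ∈ E.posCone ι, 0 ≤ φ x

/-- The product `b x b ∈ M_ι(E)` for a scalar matrix `b` and `x ∈ M_ι(E)`. -/
def compress {E : SelfadjointOperatorSpace H} {ι : Type} [Fintype ι] [DecidableEq ι]
    (b : Matrix ι ι ℂ) (x : E.Mat ι) : E.Mat ι :=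
  Mat.of fun i j => ∑ k, ∑ l, (b i k * b l j) • Mat.coeff x k l

/-- The vector space `E^# = E ⊕ ℂ` of Werner's unitisation. -/
def Unitisation (E : SelfadjointOperatorSpace H) : Type _ := E × ℂ

instance (E : SelfadjointOperatorSpace H) : AddCommGroup E.Unitisation :=
  inferInstanceAs (AddCommGroup (E × ℂ))

instance (E : SelfadjointOperatorSpace H) : Module ℂ E.Unitisation :=
  inferInstanceAs (Module ℂ (E × ℂ))

/-- The involution `(x, a)^* = (x^*, conj a)`. -/
instance (E : SelfadjointOperatorSpace H) : StarAddMonoid E.Unitisation :=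
  inferInstanceAs (StarAddMonoid (E × ℂ))

namespace Unitisation

variable {E : SelfadjointOperatorSpace H} {F : SelfadjointOperatorSpace K}

/-- The unit `(0, 1)` of `E^#`. -/
def unit (E : SelfadjointOperatorSpace H) : E.Unitisation := ((0, 1) : E × ℂ)

/-- The `M_ι(E)`-component `x` of `(x, a) ∈ M_ι(E^#) = M_ι(E) ⊕ M_ι(ℂ)`. -/
def opPart {ι : Type} [Fintype ι] [DecidableEq ι] (X : Matrix ι ι E.Unitisation) : E.Mat ι :=
  Mat.of fun i j => (X i j).1

/-- The scalar component `a` of `(x, a) ∈ M_ι(E^#) = M_ι(E) ⊕ M_ι(ℂ)`. -/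
def scalarPart {ι : Type} (X : Matrix ι ι E.Unitisation) : Matrix ι ι ℂ :=
  Matrix.of fun i j => (X i j).2

/-- The cone `M_ι(E^#)₊` of Werner's unitisation: a selfadjoint `(x, a)` is positive if `a ≥ 0` and
`φ(a_ε^{-1/2} x a_ε^{-1/2}) ≥ -1` for all `ε > 0` and `φ ∈ CCP(M_ι(E), ℂ)`, `a_ε = a + ε 1`.
(The number on the left is real, since `φ` and its argument are selfadjoint.) -/
def posCone (E : SelfadjointOperatorSpace H) (ι : Type) [Fintype ι] [DecidableEq ι] :
    Set (Matrix ι ι E.Unitisation) :=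
  {X | X.IsHermitian ∧ (scalarPart X).PosSemidef ∧
    ∀ ε : ℝ, 0 < ε → ∀ φ : E.Mat ι →ₗ[ℂ] ℂ, IsCCP φ →
      -1 ≤ (φ (compress ((scalarPart X + (ε : ℂ) • 1) ^ (-(1 / 2) : ℝ)) (opPart X))).re}

/-- The norm on `M_n(E^#)` induced by the matrix order unit `(0, 1)`: the infimum of the `t ≥ 0`
such that the block matrix `[[t, X], [X^*, t]]` is positive. -/
def matNorm {n : ℕ} (X : Matrix (Fin n) (Fin n) E.Unitisation) : ℝ :=
  sInf {t : ℝ | 0 ≤ t ∧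
    Matrix.fromBlocks (Matrix.diagonal fun _ => (t : ℂ) • unit E) X
      X.conjTranspose (Matrix.diagonal fun _ => (t : ℂ) • unit E) ∈ posCone E (Fin n ⊕ Fin n)}

/-- The unitisation `θ^# : E^# → F^#`, `(x, a) ↦ (θ(x), a)`. -/
def map (θ : E →ₗ[ℂ] F) : E.Unitisation →ₗ[ℂ] F.Unitisation :=
  LinearMap.prodMap θ (LinearMap.id : ℂ →ₗ[ℂ] ℂ)

/-- A linear map between unitisations is completely positive: it is selfadjoint and every
amplification maps the positive cone into the positive cone. -/
def IsCompletelyPositive (Θ : E.Unitisation →ₗ[ℂ] F.Unitisation) : Prop :=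
  (∀ X, Θ (star X) = star (Θ X)) ∧
    ∀ (n : ℕ), ∀ X ∈ posCone E (Fin n), X.map Θ ∈ posCone F (Fin n)

/-- A linear map between unitisations is a unital complete order embedding: it is unital,
completely positive and invertible onto its image, with completely positive inverse. -/
def IsUnitalCompleteOrderEmbedding (Θ : E.Unitisation →ₗ[ℂ] F.Unitisation) : Prop :=
  Θ (unit E) = unit F ∧ IsCompletelyPositive Θ ∧ Function.Injective Θ ∧
    ∀ (n : ℕ) (X : Matrix (Fin n) (Fin n) E.Unitisation),
      X.map Θ ∈ posCone F (Fin n) → X ∈ posCone E (Fin n)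

/-- A linear map between unitisations is completely isometric. -/
def IsCompletelyIsometric (Θ : E.Unitisation →ₗ[ℂ] F.Unitisation) : Prop :=
  ∀ (n : ℕ) (X : Matrix (Fin n) (Fin n) E.Unitisation), matNorm (X.map Θ) = matNorm X

end Unitisation

variable {E : SelfadjointOperatorSpace H} {F : SelfadjointOperatorSpace K}

/-- `θ` is an embedding: a completely isometric complete order embedding whose unitisation `θ^#`
is a unital complete order embedding. -/
def IsEmbedding (θ : E →ₗ[ℂ] F) : Prop :=
  IsCompletelyIsometric θ ∧ IsCompleteOrderEmbedding θ ∧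
    Unitisation.IsUnitalCompleteOrderEmbedding (Unitisation.map θ)

/-- For every `n`, every contractive positive functional on `M_n(E)` extends along `θ` to a
contractive positive functional on `M_n(F)`. -/
def ExtendsCCPFunctionals (θ : E →ₗ[ℂ] F) : Prop :=
  ∀ (n : ℕ) (φ : E.Mat (Fin n) →ₗ[ℂ] ℂ), IsCCP φ →
    ∃ ψ : F.Mat (Fin n) →ₗ[ℂ] ℂ, IsCCP ψ ∧ ∀ x, ψ (amp θ (Fin n) x) = φ x

/-- `θ` is a gauge maximal isometry: a completely isometric complete order embedding such that
`dist(x, M_n(E)₊) = dist(θ^(n)(x), M_n(F)₊)` for all `n` and all selfadjoint `x ∈ M_n(E)`. -/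
def IsGaugeMaximalIsometry (θ : E →ₗ[ℂ] F) : Prop :=
  IsCompletelyIsometric θ ∧ IsCompleteOrderEmbedding θ ∧
    ∀ (n : ℕ) (x : E.Mat (Fin n)), IsSelfAdjoint x →
      Metric.infDist x (E.posCone (Fin n)) =
        Metric.infDist (amp θ (Fin n) x) (F.posCone (Fin n))

end SelfadjointOperatorSpace

end

/-! Everything reduces to one duality. For a cone of selfadjoint elements containing 0, `p(x) =
dist(Re x, C)` is sublinear, and the real functionals dominated by `p` are exactly the negatives of
the real parts of contractive positive functionals. By Hahn–Banach, a selfadjoint `x` has `dist(x,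
C) ≤ t` iff `Re φ(x) ≥ -t` for all such functionals `φ`
(`infDist_le_iff_forall_isContractivePositive`); a map preserving the distance lets functionals
extend (`IsContractivePositive.exists_extension`), so 4 implies 3.

The cones of the unitisation see the space only through contractive positive functionals. These
always restrict along `θ`, and under 3 they also extend, so `θ^#` preserves and reflects the cones;
the norms are defined by the cones, which gives 1 and 2.

Conversely, the distance is recovered from either structure. By duality `(x, t1)` is positive iff
`dist(x, M_n(E)₊) ≤ t`, so 1 implies 4. For 2, take `a ≥ ‖x‖`: the block matrix defining the norm of
`X = (x, -a1)` is unitarily equivalent to `(t + X) ⊕ (t - X)`. The second summand imposes no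
constraint, so the norm of `X` equals `a + dist(x, M_n(E)₊)` (`matNorm_ofMatScalar`). -/

section ConeDuality

/-! ### Duality between the distance to a cone and contractive positive functionals -/

variable {V : Type*} [NormedAddCommGroup V] [NormedSpace ℂ V]

theorem ConvexCone.infDist_smul_le (C : ConvexCone ℝ V) (hC : (C : Set V).Nonempty)
    {c : ℝ} (hc : 0 < c) (x : V) :
    Metric.infDist (c • x) C ≤ c * Metric.infDist x C := by
  refine le_of_forall_pos_lt_add fun δ hδ => ?_
  obtain ⟨p, hp, hxp⟩ := (Metric.infDist_lt_iff hC).1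
    (lt_add_of_pos_right (Metric.infDist x C) (div_pos hδ hc))
  refine (Metric.infDist_le_dist_of_mem (C.smul_mem hc hp)).trans_lt ?_
  rw [dist_smul₀, Real.norm_of_nonneg hc.le]
  calc c * dist x p < c * (Metric.infDist x C + δ / c) := by gcongr
    _ = c * Metric.infDist x C + δ := by field_simp

theorem ConvexCone.infDist_smul (C : ConvexCone ℝ V) (hC : (C : Set V).Nonempty)
    {c : ℝ} (hc : 0 < c) (x : V) :
    Metric.infDist (c • x) C = c * Metric.infDist x C := by
  refine le_antisymm (C.infDist_smul_le hC hc x) ?_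
  have h := C.infDist_smul_le hC (inv_pos.2 hc) (c • x)
  rw [smul_smul, inv_mul_cancel₀ hc.ne', one_smul] at h
  calc c * Metric.infDist x C ≤ c * (c⁻¹ * Metric.infDist (c • x) C) := by gcongr
    _ = Metric.infDist (c • x) C := by field_simp

/-- Near-optimal cone points for `x` and `y` add up to a cone point for `x + y`. With `infDist_smul`
this makes the distance a sublinear functional, as Hahn–Banach requires. -/
theorem ConvexCone.infDist_add_le (C : ConvexCone ℝ V) (hC : (C : Set V).Nonempty) (x y : V) :
    Metric.infDist (x + y) C ≤ Metric.infDist x C + Metric.infDist y C := by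
  refine le_of_forall_pos_lt_add fun δ hδ => ?_
  obtain ⟨p, hp, hxp⟩ := (Metric.infDist_lt_iff hC).1
    (lt_add_of_pos_right (Metric.infDist x C) (half_pos hδ))
  obtain ⟨q, hq, hyq⟩ := (Metric.infDist_lt_iff hC).1
    (lt_add_of_pos_right (Metric.infDist y C) (half_pos hδ))
  refine (Metric.infDist_le_dist_of_mem (C.add_mem hp hq)).trans_lt ?_
  linarith [dist_add_add_le x y p q]

variable [StarAddMonoid V]

/-- A contractive functional that is selfadjoint and nonnegative on the cone `C`. -/
def IsContractivePositive (C : ConvexCone ℝ V) (φ : V →ₗ[ℂ] ℂ) : Prop :=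
  (∀ x, ‖φ x‖ ≤ ‖x‖) ∧ (∀ x, φ (star x) = star (φ x)) ∧ ∀ x ∈ C, 0 ≤ φ x

variable [StarModule ℂ V]

/-- The distance of the real part of `x` to the cone `C`. -/
noncomputable def realPartDist (C : ConvexCone ℝ V) (x : V) : ℝ :=
  Metric.infDist (realPart x : V) C


theorem realPartDist_nonneg (C : ConvexCone ℝ V) (x : V) : 0 ≤ realPartDist C x :=
  Metric.infDist_nonneg

theorem realPartDist_of_isSelfAdjoint (C : ConvexCone ℝ V) {x : V} (hx : IsSelfAdjoint x) :
    realPartDist C x = Metric.infDist x C := by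
  rw [realPartDist, hx.coe_realPart]

theorem realPartDist_smul (C : ConvexCone ℝ V) (hC : (C : Set V).Nonempty)
    {c : ℝ} (hc : 0 < c) (x : V) : realPartDist C (c • x) = c * realPartDist C x := by
  rw [realPartDist, map_smul, selfAdjoint.val_smul, C.infDist_smul hC hc, realPartDist]

theorem realPartDist_add_le (C : ConvexCone ℝ V) (hC : (C : Set V).Nonempty) (x y : V) :
    realPartDist C (x + y) ≤ realPartDist C x + realPartDist C y := by
  rw [realPartDist, map_add, AddSubgroup.coe_add]
  exact C.infDist_add_le hC _ _

theorem realPart_I_smul_of_isSelfAdjoint {x : V} (hx : IsSelfAdjoint x) :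
    realPart (Complex.I • x) = 0 := by
  rw [realPart_I_smul, hx.imaginaryPart, neg_zero]

theorem IsContractivePositive.re_apply_realPart {C : ConvexCone ℝ V} {φ : V →ₗ[ℂ] ℂ}
    (hφ : IsContractivePositive C φ) (x : V) : (φ (realPart x)).re = (φ x).re := by
  rw [realPart_apply_coe, ← Complex.coe_smul, map_smul, map_add, hφ.2.1]
  simp
  ring

/-- The easy half of the duality: for selfadjoint `x` and `p` in the cone, `-Re φ(x) ≤ Re φ(p - x) ≤
‖x - p‖`; take the infimum over `p`. -/
theorem IsContractivePositive.neg_re_le_realPartDist {C : ConvexCone ℝ V}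
    (hC : (C : Set V).Nonempty) {φ : V →ₗ[ℂ] ℂ} (hφ : IsContractivePositive C φ) (x : V) :
    -(φ x).re ≤ realPartDist C x := by
  rw [← hφ.re_apply_realPart x]
  refine (Metric.le_infDist hC).2 fun p hp => ?_
  have h1 := (Complex.le_def.1 (hφ.2.2 p hp)).1
  have h2 := (Complex.abs_re_le_norm _).trans (hφ.1 (realPart x - p))
  rw [map_sub, Complex.sub_re, ← dist_eq_norm] at h2
  have h3 := (abs_le.1 h2).1
  simp only [Complex.zero_re] at h1
  linarith

variable [NormedStarGroup V]

theorem norm_realPart_le (x : V) : ‖(realPart x : V)‖ ≤ ‖x‖ := by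
  rw [realPart_apply_coe, norm_smul, Real.norm_of_nonneg (by norm_num)]
  have := norm_add_le x (star x)
  rw [norm_star] at this
  linarith

/-- A real functional dominated by the distance to the cone is, up to sign, the real part of a
contractive positive functional. -/
theorem exists_isContractivePositive_of_le_realPartDist (C : ConvexCone ℝ V) (h0 : (0 : V) ∈ C)
    (hCsa : ∀ x ∈ C, IsSelfAdjoint x) (g : V →ₗ[ℝ] ℝ) (hg : ∀ x, g x ≤ realPartDist C x) :
    ∃ φ : V →ₗ[ℂ] ℂ, IsContractivePositive C φ ∧ ∀ x, (φ x).re = -g x := by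
  have hle : ∀ x, g x ≤ ‖x‖ := fun x => by
    refine (hg x).trans ((Metric.infDist_le_dist_of_mem h0).trans ?_)
    rw [dist_zero_right]
    exact norm_realPart_le x
  -- The gauge vanishes at skew elements, and both `x` and `-x` are skew. Hence `g` depends only on
  -- the real part, which makes `φ` selfadjoint.
  have hskew : ∀ x, realPart x = 0 → g x = 0 := fun x hx => by
    have hz : ∀ y : V, realPart y = 0 → g y ≤ 0 := fun y hy => by
      refine (hg y).trans_eq ?_
      rw [realPartDist, hy]
      exact Metric.infDist_zero_of_mem h0
    have h2 := hz (-x) (by rw [map_neg, hx, neg_zero])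
    rw [map_neg] at h2
    linarith [hz x hx]
  have hstar : ∀ x, g (star x) = g x := fun x => by
    rw [← sub_eq_zero, ← map_sub]
    refine hskew _ (Subtype.ext ?_)
    rw [realPart_apply_coe, star_sub, star_star]
    simp
  let φ : V →ₗ[ℂ] ℂ := Module.Dual.extendRCLike (𝕜 := ℂ) (-g)
  have hre : ∀ x, (φ x).re = -g x := fun x => Module.Dual.re_extendRCLike_apply (𝕜 := ℂ) (-g) x
  have him : ∀ x, (φ x).im = g (Complex.I • x) := fun x => by
    exact (Module.Dual.im_extendRCLike_apply (𝕜 := ℂ) (-g) x).trans (neg_neg _)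
  have hφstar : ∀ x, φ (star x) = star (φ x) := fun x => by
    apply Complex.ext
    · rw [hre, hstar, Complex.star_def, Complex.conj_re, hre]
    · rw [Complex.star_def, Complex.conj_im, him, him, ← hstar, star_smul, star_star,
        Complex.star_def, Complex.conj_I, neg_smul, map_neg]
  refine ⟨φ, ⟨fun x => ?_, hφstar, fun x hx => ?_⟩, hre⟩
  -- The usual rotation: `‖φ x‖²` is `-g` at `conj (φ x) • x`, hence at most `‖φ x‖ ‖x‖`.
  · have h := Module.Dual.norm_extendRCLike_apply_sq (𝕜 := ℂ) (-g) x
    change ‖φ x‖ ^ 2 = -g (starRingEnd ℂ (φ x) • x) at h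
    have h2 := hle (-(starRingEnd ℂ (φ x) • x))
    rw [map_neg, norm_neg, norm_smul, RCLike.norm_conj, ← h, sq] at h2
    by_contra! hlt
    exact absurd h2 (not_le.2 (mul_lt_mul_of_pos_left hlt ((norm_nonneg x).trans_lt hlt)))
  · refine Complex.le_def.2 ⟨?_, ?_⟩
    · rw [hre, Complex.zero_re]
      have h := hg x
      rw [realPartDist_of_isSelfAdjoint C (hCsa x hx), Metric.infDist_zero_of_mem hx] at h
      linarith
    · rw [him, hskew _ (realPart_I_smul_of_isSelfAdjoint (hCsa x hx)), Complex.zero_im]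

/-- The distance of a selfadjoint element to the cone is determined by the contractive positive
functionals. -/
theorem infDist_le_iff_forall_isContractivePositive (C : ConvexCone ℝ V) (h0 : (0 : V) ∈ C)
    (hCsa : ∀ x ∈ C, IsSelfAdjoint x) {x : V} (hx : IsSelfAdjoint x) (t : ℝ) :
    Metric.infDist x C ≤ t ↔ ∀ φ : V →ₗ[ℂ] ℂ, IsContractivePositive C φ → -t ≤ (φ x).re := by
  have hC : (C : Set V).Nonempty := ⟨0, h0⟩
  rw [← realPartDist_of_isSelfAdjoint C hx]
  refine ⟨fun h φ hφ => ?_, fun h => ?_⟩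
  · linarith [hφ.neg_re_le_realPartDist hC x]
  rcases eq_or_ne x 0 with rfl | hx0
  · have hz : IsContractivePositive C (0 : V →ₗ[ℂ] ℂ) :=
      ⟨fun x => by simp, fun x => by simp, fun x _ => by simp⟩
    have := h 0 hz
    rw [realPartDist_of_isSelfAdjoint C hx, Metric.infDist_zero_of_mem h0]
    simp at this
    exact this
  -- On the line `ℝx` start from `c x ↦ c · dist(x, C)`: it equals the gauge for `c > 0` and is
  -- nonpositive for `c ≤ 0`. The resulting `φ` satisfies `-Re φ(x) = dist(x, C)`.
  obtain ⟨g, hgx, hg⟩ := exists_extension_of_le_sublinear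
    (LinearPMap.mkSpanSingleton x (realPartDist C x) hx0) (realPartDist C)
    (fun c hc y => realPartDist_smul C hC hc y) (realPartDist_add_le C hC) (by
      rintro ⟨y, hy⟩
      obtain ⟨c, rfl⟩ := Submodule.mem_span_singleton.1 hy
      rw [LinearPMap.mkSpanSingleton'_apply, smul_eq_mul]
      rcases lt_or_ge 0 c with hc | hc
      · exact (realPartDist_smul C hC hc x).ge
      · exact (mul_nonpos_of_nonpos_of_nonneg hc (realPartDist_nonneg C x)).trans
          (realPartDist_nonneg C _))
  obtain ⟨φ, hφ, hre⟩ := exists_isContractivePositive_of_le_realPartDist C h0 hCsa g hg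
  have h1 := h φ hφ
  have h2 := hgx ⟨x, Submodule.mem_span_singleton_self x⟩
  rw [LinearPMap.mkSpanSingleton_apply] at h2
  rw [hre] at h1
  change g x = _ at h2
  linarith

variable {W : Type*} [NormedAddCommGroup W] [NormedSpace ℂ W] [StarAddMonoid W] [StarModule ℂ W]

/-- Contractive positive functionals extend along injective linear maps that preserve the distance
to the cone. -/
theorem IsContractivePositive.exists_extension {C : ConvexCone ℝ V} (h0 : (0 : V) ∈ C)
    (hCsa : ∀ x ∈ C, IsSelfAdjoint x) {D : ConvexCone ℝ W} (hD : (D : Set W).Nonempty)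
    (T : W →ₗ[ℂ] V) (hT : Function.Injective T)
    (hdist : ∀ x, realPartDist D x ≤ realPartDist C (T x))
    {φ : W →ₗ[ℂ] ℂ} (hφ : IsContractivePositive D φ) :
    ∃ ψ : V →ₗ[ℂ] ℂ, IsContractivePositive C ψ ∧ ∀ x, ψ (T x) = φ x := by
  have hC : (C : Set V).Nonempty := ⟨0, h0⟩
  let e := LinearEquiv.ofInjective (T.restrictScalars ℝ) hT
  let f : W →ₗ[ℝ] ℝ := -(Complex.reLm ∘ₗ φ.restrictScalars ℝ)
  obtain ⟨g, hgf, hg⟩ := exists_extension_of_le_sublinear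
    ⟨LinearMap.range (T.restrictScalars ℝ), f ∘ₗ e.symm.toLinearMap⟩ (realPartDist C)
    (fun c hc y => realPartDist_smul C hC hc y) (realPartDist_add_le C hC) (by
      intro y
      obtain ⟨x, rfl⟩ := e.surjective y
      have h : (f ∘ₗ e.symm.toLinearMap) (e x) = -(φ x).re := by simp [f]
      exact h.trans_le ((hφ.neg_re_le_realPartDist hD x).trans (hdist x)))
  obtain ⟨ψ, hψ, hre⟩ := exists_isContractivePositive_of_le_realPartDist C h0 hCsa g hg
  have hψφ : ∀ x, (ψ (T x)).re = (φ x).re := fun x => by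
    have h2 : g (T x) = (f ∘ₗ e.symm.toLinearMap) (e x) := hgf (e x)
    rw [hre, h2]
    simp [f]
  refine ⟨ψ, hψ, fun x => Complex.ext (hψφ x) ?_⟩
  -- Real parts at `i x` determine imaginary parts at `x`.
  have h := hψφ (Complex.I • x)
  rw [map_smul, map_smul, map_smul] at h
  simpa using h

end ConeDuality

namespace SelfadjointOperatorSpace

/-! ### Scalar matrices acting on direct sums of `H` -/

section ScalarMatrices

variable {H : Type*} [NormedAddCommGroup H] [InnerProductSpace ℂ H]
variable {ι κ μ : Type} [Fintype ι] [DecidableEq ι] [Fintype κ] [DecidableEq κ] [Fintype μ]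
  [DecidableEq μ]

/-- The operator `H^ι → H^κ` given by a scalar matrix. -/
noncomputable def scalarOp (H : Type*) [NormedAddCommGroup H] [InnerProductSpace ℂ H]
    (b : Matrix κ ι ℂ) : PiLp 2 (fun _ : ι => H) →L[ℂ] PiLp 2 (fun _ : κ => H) :=
  ∑ i, ∑ j, b i j • (blockIncl H κ i ∘L PiLp.proj 2 (fun _ : ι => H) j)

omit [DecidableEq ι] in
theorem scalarOp_apply (b : Matrix κ ι ℂ) (v : PiLp 2 (fun _ : ι => H)) (i : κ) :
    scalarOp H b v i = ∑ j, b i j • v j := by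
  simp [scalarOp, blockIncl_apply]

omit [DecidableEq ι] in
theorem scalarOp_mul (b : Matrix μ κ ℂ) (c : Matrix κ ι ℂ) :
    scalarOp H (b * c) = scalarOp H b ∘L scalarOp H c := by
  ext v i
  simp only [scalarOp_apply, ContinuousLinearMap.comp_apply, Matrix.mul_apply, Finset.sum_smul,
    Finset.smul_sum, mul_smul]
  exact Finset.sum_comm

theorem scalarOp_one : scalarOp H (1 : Matrix ι ι ℂ) = ContinuousLinearMap.id ℂ _ := by
  ext v i
  simp [scalarOp_apply, Matrix.one_apply]

omit [DecidableEq ι] in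
theorem scalarOp_zero : scalarOp H (0 : Matrix κ ι ℂ) = 0 := by
  ext v i
  simp [scalarOp_apply]

omit [DecidableEq ι] in
theorem scalarOp_add (b c : Matrix κ ι ℂ) :
    scalarOp H (b + c) = scalarOp H b + scalarOp H c := by
  ext v i
  simp [scalarOp_apply, add_smul, Finset.sum_add_distrib]

theorem inner_scalarOp (b : Matrix κ ι ℂ) (v : PiLp 2 (fun _ : ι => H))
    (w : PiLp 2 (fun _ : κ => H)) :
    inner ℂ (scalarOp H b v) w = inner ℂ v (scalarOp H b.conjTranspose w) := by
  simp only [PiLp.inner_apply, scalarOp_apply, sum_inner, inner_sum, inner_smul_left,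
    inner_smul_right, Matrix.conjTranspose_apply, Complex.star_def]
  exact Finset.sum_comm

theorem adjoint_scalarOp [CompleteSpace H] (b : Matrix κ ι ℂ) :
    ContinuousLinearMap.adjoint (scalarOp H b) = scalarOp H b.conjTranspose := by
  symm
  rw [ContinuousLinearMap.eq_adjoint_iff]
  intro v w
  rw [inner_scalarOp, Matrix.conjTranspose_conjTranspose]

theorem norm_scalarOp_apply {b : Matrix κ ι ℂ} (hb : b.conjTranspose * b = 1)
    (v : PiLp 2 (fun _ : ι => H)) : ‖scalarOp H b v‖ = ‖v‖ := by
  have h := inner_scalarOp b v (scalarOp H b v)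
  rw [← ContinuousLinearMap.comp_apply, ← scalarOp_mul, hb, scalarOp_one] at h
  rw [norm_eq_sqrt_re_inner (𝕜 := ℂ), h, norm_eq_sqrt_re_inner (𝕜 := ℂ) v]
  rfl

theorem norm_scalarOp_le {b : Matrix κ ι ℂ} (hb : b.conjTranspose * b = 1) :
    ‖scalarOp H b‖ ≤ 1 :=
  ContinuousLinearMap.opNorm_le_bound _ zero_le_one fun v => by
    rw [norm_scalarOp_apply hb, one_mul]

theorem norm_scalarOp_conjTranspose_le [CompleteSpace H] {b : Matrix κ ι ℂ}
    (hb : b.conjTranspose * b = 1) : ‖scalarOp H b.conjTranspose‖ ≤ 1 := by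
  rw [← adjoint_scalarOp, LinearIsometryEquiv.norm_map]
  exact norm_scalarOp_le hb

theorem entry_scalarOp_comp (b : Matrix κ ι ℂ) (c : Matrix ι κ ℂ) (T : BlockOp H ι) (i j : κ) :
    entry (scalarOp H b ∘L T ∘L scalarOp H c) i j =
      ∑ k, ∑ l, (b i k * c l j) • entry T k l := by
  ext h
  have hc : scalarOp H c (blockIncl H κ j h) = ∑ l, blockIncl H ι l (c l j • h) := by
    ext l
    simp [scalarOp_apply, blockIncl_apply]
  simp only [entry_apply, ContinuousLinearMap.comp_apply, hc, scalarOp_apply, map_sum, map_smul,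
    _root_.sum_apply, _root_.smul_apply, Finset.smul_sum, mul_smul,
    WithLp.ofLp_sum, Finset.sum_apply, PiLp.smul_apply]
  rw [Finset.sum_comm]
  exact Finset.sum_congr rfl fun k _ => Finset.sum_congr rfl fun l _ => smul_comm _ _ _

end ScalarMatrices

/-! ### Conjugation of `M_ι(E)` by scalar matrices, and its positive cone -/

variable {H : Type*} [NormedAddCommGroup H] [InnerProductSpace ℂ H] [CompleteSpace H]
variable {K : Type*} [NormedAddCommGroup K] [InnerProductSpace ℂ K] [CompleteSpace K]
variable {E : SelfadjointOperatorSpace H} {F : SelfadjointOperatorSpace K}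
variable {ι κ μ : Type} [Fintype ι] [DecidableEq ι] [Fintype κ] [DecidableEq κ] [Fintype μ]
  [DecidableEq μ]

instance : StarModule ℂ (E.Mat ι) where
  star_smul c x := Subtype.ext (star_smul c (x : BlockOp H ι))

instance : NormedStarGroup (E.Mat ι) where
  norm_star_le x := (norm_star (x : BlockOp H ι)).le

theorem Mat.coe_star (x : E.Mat ι) : ((star x : E.Mat ι) : BlockOp H ι) = star (x : BlockOp H ι) :=
  rfl

theorem Mat.ext_coeff {x y : E.Mat ι} (h : ∀ i j, coeff x i j = coeff y i j) : x = y := by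
  apply Subtype.ext
  rw [← ofEntries_entry (x : BlockOp H ι), ← ofEntries_entry (y : BlockOp H ι)]
  congr 1
  ext1 i
  ext1 j
  exact congrArg Subtype.val (h i j)

theorem Mat.coeff_of (A : ι → ι → E) (i j : ι) : coeff (of A) i j = A i j :=
  Subtype.ext (entry_ofEntries _ i j)

theorem Mat.coeff_smul (c : ℂ) (x : E.Mat ι) (i j : ι) :
    coeff (c • x) i j = c • coeff x i j :=
  Subtype.ext (by ext; simp [coeff, entry])

theorem Mat.coeff_sub (x y : E.Mat ι) (i j : ι) :
    coeff (x - y) i j = coeff x i j - coeff y i j :=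
  Subtype.ext (by ext; simp [coeff, entry])

theorem Mat.coeff_star (x : E.Mat ι) (i j : ι) : coeff (star x) i j = star (coeff x j i) :=
  Subtype.ext (entry_star _ i j)

theorem coeff_amp (θ : E →ₗ[ℂ] F) (x : E.Mat ι) (i j : ι) :
    Mat.coeff (amp θ ι x) i j = θ (Mat.coeff x i j) :=
  Mat.coeff_of _ i j

/-- The product `b x b^*` for a scalar matrix `b`. -/
noncomputable def Mat.conj (b : Matrix κ ι ℂ) : E.Mat ι →ₗ[ℂ] E.Mat κ where
  toFun x := ⟨scalarOp H b ∘L (x : BlockOp H ι) ∘L scalarOp H b.conjTranspose, fun i j => by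
    rw [entry_scalarOp_comp]
    exact sum_mem fun k _ => sum_mem fun l _ => E.toSubmodule.smul_mem _ (x.2 k l)⟩
  map_add' x y := Subtype.ext (by ext; simp)
  map_smul' c x := Subtype.ext (by ext; simp)

theorem Mat.coe_conj (b : Matrix κ ι ℂ) (x : E.Mat ι) : (conj b x : BlockOp H κ) =
    scalarOp H b ∘L (x : BlockOp H ι) ∘L scalarOp H b.conjTranspose := rfl

theorem Mat.coeff_conj (b : Matrix κ ι ℂ) (x : E.Mat ι) (i j : κ) :
    coeff (conj b x) i j = ∑ k, ∑ l, (b i k * star (b j l)) • coeff x k l := by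
  apply Subtype.ext
  refine (entry_scalarOp_comp b b.conjTranspose (x : BlockOp H ι) i j).trans ?_
  simp [coeff]

theorem amp_conj (θ : E →ₗ[ℂ] F) (b : Matrix κ ι ℂ) (x : E.Mat ι) :
    amp θ κ (Mat.conj b x) = Mat.conj b (amp θ ι x) :=
  Mat.ext_coeff fun i j => by simp [coeff_amp, Mat.coeff_conj]

theorem amp_compress (θ : E →ₗ[ℂ] F) (b : Matrix ι ι ℂ) (x : E.Mat ι) :
    amp θ ι (compress b x) = compress b (amp θ ι x) :=
  Mat.ext_coeff fun i j => by simp [coeff_amp, compress, Mat.coeff_of]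

theorem compress_eq_conj {b : Matrix ι ι ℂ} (hb : b.IsHermitian) (x : E.Mat ι) :
    compress b x = Mat.conj b x :=
  Mat.ext_coeff fun i j => by simp only [compress, Mat.coeff_of, Mat.coeff_conj, hb.apply]

theorem Mat.conj_conj (b : Matrix μ κ ℂ) (c : Matrix κ ι ℂ) (x : E.Mat ι) :
    conj b (conj c x) = conj (b * c) x :=
  Subtype.ext (by
    simp only [coe_conj, scalarOp_mul, Matrix.conjTranspose_mul, ContinuousLinearMap.comp_assoc])

theorem Mat.conj_one (x : E.Mat ι) : conj 1 x = x :=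
  Subtype.ext (by simp [coe_conj, scalarOp_one])

theorem Mat.conj_zero (x : E.Mat ι) : conj (0 : Matrix κ ι ℂ) x = 0 :=
  Subtype.ext (by simp [coe_conj, scalarOp_zero])

theorem Mat.conj_real_smul (c : ℝ) (b : Matrix κ ι ℂ) (x : E.Mat ι) :
    conj ((c : ℂ) • b) x = (c ^ 2 : ℝ) • conj b x := by
  refine ext_coeff fun i j => ?_
  rw [← Complex.coe_smul, coeff_smul, coeff_conj, coeff_conj]
  simp only [Finset.smul_sum, smul_smul, Matrix.smul_apply, smul_eq_mul, star_mul',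
    Complex.star_def, Complex.conj_ofReal, Complex.ofReal_pow]
  refine Finset.sum_congr rfl fun k _ => Finset.sum_congr rfl fun l _ => ?_
  congr 1
  ring

theorem Mat.real_smul_sub (c : ℝ) (x y : E.Mat ι) : c • (x - y) = c • x - c • y :=
  smul_sub (c : ℂ) x y

theorem Mat.norm_real_smul {c : ℝ} (hc : 0 ≤ c) (x : E.Mat ι) : ‖c • x‖ = c * ‖x‖ := by
  refine (norm_smul (c : ℂ) x).trans ?_
  rw [Complex.norm_of_nonneg hc]

theorem Mat.conj_smul_real (b : Matrix κ ι ℂ) (c : ℝ) (x : E.Mat ι) :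
    conj b (c • x) = c • conj b x := by
  rw [← Complex.coe_smul, map_smul, Complex.coe_smul]

theorem Mat.conj_star (b : Matrix κ ι ℂ) (x : E.Mat ι) : conj b (star x) = star (conj b x) := by
  apply Subtype.ext
  rw [coe_star, coe_conj, coe_conj, coe_star, ContinuousLinearMap.star_eq_adjoint,
    ContinuousLinearMap.star_eq_adjoint, ContinuousLinearMap.adjoint_comp,
    ContinuousLinearMap.adjoint_comp, adjoint_scalarOp, adjoint_scalarOp,
    Matrix.conjTranspose_conjTranspose, ContinuousLinearMap.comp_assoc]

theorem Mat.conj_mem_posCone (b : Matrix κ ι ℂ) {x : E.Mat ι} (hx : x ∈ E.posCone ι) :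
    conj b x ∈ E.posCone κ := by
  change ((conj b x : E.Mat κ) : BlockOp H κ).IsPositive
  rw [coe_conj, ← adjoint_scalarOp]
  exact ContinuousLinearMap.IsPositive.conj_adjoint hx _

theorem Mat.norm_conj_le {b : Matrix κ ι ℂ} (h : ‖scalarOp H b‖ ≤ 1) (x : E.Mat ι) :
    ‖conj b x‖ ≤ ‖x‖ := by
  have h' : ‖scalarOp H b.conjTranspose‖ ≤ 1 := by
    rwa [← adjoint_scalarOp, LinearIsometryEquiv.norm_map]
  change ‖scalarOp H b ∘L (x : BlockOp H ι) ∘L scalarOp H b.conjTranspose‖ ≤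
    ‖(x : BlockOp H ι)‖
  calc _ ≤ ‖scalarOp H b‖ * (‖(x : BlockOp H ι)‖ * ‖scalarOp H b.conjTranspose‖) :=
        (ContinuousLinearMap.opNorm_comp_le _ _).trans
          (by gcongr; exact ContinuousLinearMap.opNorm_comp_le _ _)
    _ ≤ 1 * (‖(x : BlockOp H ι)‖ * 1) := by gcongr
    _ = _ := by ring

/-- Conjugation by a contraction is contractive, selfadjoint and positive. This moves functionals
between index sets, later via permutation matrices and the diagonal embedding. -/
theorem IsCCP.comp_conj {φ : E.Mat κ →ₗ[ℂ] ℂ} (hφ : IsCCP φ) {b : Matrix κ ι ℂ}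
    (h : ‖scalarOp H b‖ ≤ 1) : IsCCP (φ ∘ₗ Mat.conj b) :=
  ⟨fun x => (hφ.1 _).trans (Mat.norm_conj_le h x),
    fun x => by simp only [LinearMap.comp_apply, Mat.conj_star, hφ.2.1],
    fun _ hx => hφ.2.2 _ (Mat.conj_mem_posCone b hx)⟩

/-- If `v` and `w` are isometries whose ranges are complementary, then
`v x v^* + w y w^*` is an orthogonal direct sum. -/
theorem Mat.norm_conj_add_conj_le {v : Matrix κ ι ℂ} {w : Matrix κ μ ℂ}
    (hv : v.conjTranspose * v = 1) (hw : w.conjTranspose * w = 1)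
    (hvw : v.conjTranspose * w = 0)
    (h1 : v * v.conjTranspose + w * w.conjTranspose = 1) (x : E.Mat ι) (y : E.Mat μ) {c : ℝ}
    (hx : ‖x‖ ≤ c) (hy : ‖y‖ ≤ c) : ‖conj v x + conj w y‖ ≤ c := by
  have hc : 0 ≤ c := (norm_nonneg x).trans hx
  -- The relation `v^* w = 0` makes the ranges orthogonal, while `v v^* + w w^* = 1` below writes
  -- every vector as `v p + w q`.
  have pyth : ∀ (p : PiLp 2 (fun _ : ι => H)) (q : PiLp 2 (fun _ : μ => H)),
      ‖scalarOp H v p + scalarOp H w q‖ ^ 2 = ‖p‖ ^ 2 + ‖q‖ ^ 2 := fun p q => by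
    have horth : inner ℂ (scalarOp H v p) (scalarOp H w q) = 0 := by
      rw [inner_scalarOp, ← ContinuousLinearMap.comp_apply, ← scalarOp_mul, hvw, scalarOp_zero]
      simp
    rw [sq, norm_add_sq_eq_norm_sq_add_norm_sq_of_inner_eq_zero _ _ horth, norm_scalarOp_apply hv,
      norm_scalarOp_apply hw, sq, sq]
  change ‖((conj v x : E.Mat κ) : BlockOp H κ) + ((conj w y : E.Mat κ) : BlockOp H κ)‖ ≤ c
  refine ContinuousLinearMap.opNorm_le_bound _ hc fun h => ?_
  set p := scalarOp H v.conjTranspose h with hp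
  set q := scalarOp H w.conjTranspose h with hq
  have hh : ‖h‖ ^ 2 = ‖p‖ ^ 2 + ‖q‖ ^ 2 := by
    rw [← pyth, hp, hq, ← ContinuousLinearMap.comp_apply, ← ContinuousLinearMap.comp_apply,
      ← scalarOp_mul, ← scalarOp_mul, ← _root_.add_apply, ← scalarOp_add, h1,
      scalarOp_one]
    rfl
  rw [← sq_le_sq₀ (norm_nonneg _) (by positivity)]
  calc ‖scalarOp H v ((x : BlockOp H ι) p) + scalarOp H w ((y : BlockOp H μ) q)‖ ^ 2
      = ‖(x : BlockOp H ι) p‖ ^ 2 + ‖(y : BlockOp H μ) q‖ ^ 2 := pyth _ _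
    _ ≤ (c * ‖p‖) ^ 2 + (c * ‖q‖) ^ 2 := by
        gcongr
        · exact (x : BlockOp H ι).le_of_opNorm_le hx p
        · exact (y : BlockOp H μ).le_of_opNorm_le hy q
    _ = (c * ‖h‖) ^ 2 := by rw [mul_pow, mul_pow, mul_pow, hh, mul_add]

/-- The positive cone of `M_ι(E)` as a convex cone. -/
def posConvexCone (E : SelfadjointOperatorSpace H) (ι : Type) [Fintype ι] [DecidableEq ι] :
    ConvexCone ℝ (E.Mat ι) where
  carrier := E.posCone ι
  smul_mem' c hc x hx := by
    change ((c : ℂ) • (x : BlockOp H ι)).IsPositive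
    exact ContinuousLinearMap.IsPositive.smul_of_nonneg hx (by simpa using hc.le)
  add_mem' x hx y hy := ContinuousLinearMap.IsPositive.add hx hy

theorem zero_mem_posConvexCone : (0 : E.Mat ι) ∈ E.posConvexCone ι :=
  ContinuousLinearMap.isPositive_zero

theorem isSelfAdjoint_of_mem_posConvexCone (x : E.Mat ι) (hx : x ∈ E.posConvexCone ι) :
    IsSelfAdjoint x :=
  Subtype.ext (ContinuousLinearMap.IsPositive.isSelfAdjoint hx)

theorem infDist_posCone_le_iff {x : E.Mat ι} (hx : IsSelfAdjoint x) (t : ℝ) :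
    Metric.infDist x (E.posCone ι) ≤ t ↔
      ∀ φ : E.Mat ι →ₗ[ℂ] ℂ, IsCCP φ → -t ≤ (φ x).re :=
  infDist_le_iff_forall_isContractivePositive (E.posConvexCone ι) zero_mem_posConvexCone
    isSelfAdjoint_of_mem_posConvexCone hx t

end SelfadjointOperatorSpace

/-! ### Inverse square roots of positive matrices -/

section NegHalfPower

variable {κ : Type*} [Fintype κ] [DecidableEq κ]

/-- A positive `B` with `B²` inverse to `M` is invertible and `M = B^{-2}`, so the power `-1/2`
returns `B`. The functional-calculus power can thus be computed by exhibiting `B`. -/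
theorem Matrix.PosSemidef.rpow_neg_half_eq {B M : Matrix κ κ ℂ} (hB : B.PosSemidef)
    (h : M * (B * B) = 1) : M ^ (-(1 / 2) : ℝ) = B := by
  have hBu : IsUnit B := by
    refine IsUnit.of_mul_eq_one_right (M * B) ?_
    rw [mul_assoc, h]
  have hBp : IsStrictlyPositive B := ⟨hB.nonneg, hBu⟩
  have hM : M = B ^ (-2 : ℝ) := by
    have h2 : B ^ (-2 : ℝ) * (B * B) = 1 := by
      have h3 := CFC.rpow_neg_mul_rpow (a := B) 2 hBp
      rwa [show (2 : ℝ) = ((2 : ℕ) : ℝ) by norm_num, CFC.rpow_natCast B 2 hBp.nonneg, sq] at h3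
    have h4 : (B * B) * M = 1 := mul_eq_one_comm.1 h
    calc M = (B ^ (-2 : ℝ) * (B * B)) * M := by rw [h2, one_mul]
      _ = B ^ (-2 : ℝ) := by rw [mul_assoc, h4, mul_one]
  rw [hM, CFC.rpow_rpow B _ _ (by norm_num) hBp]
  norm_num
  exact CFC.rpow_one B hBp.nonneg

/-- On complementary orthogonal projections the power acts on each coefficient separately; `γ` and
`δ` are `c^{-1/2}` and `d^{-1/2}`. -/
theorem Matrix.PosSemidef.rpow_neg_half_add {P Q : Matrix κ κ ℂ} (hP : P.PosSemidef)
    (hQ : Q.PosSemidef) (hPP : P * P = P) (hQQ : Q * Q = Q) (hPQ : P * Q = 0) (hQP : Q * P = 0)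
    (h1 : P + Q = 1) {c d γ δ : ℝ} (hγ : 0 ≤ γ) (hδ : 0 ≤ δ) (hc : c * γ ^ 2 = 1)
    (hd : d * δ ^ 2 = 1) :
    ((c : ℂ) • P + (d : ℂ) • Q) ^ (-(1 / 2) : ℝ) = (γ : ℂ) • P + (δ : ℂ) • Q := by
  refine PosSemidef.rpow_neg_half_eq
    ((hP.smul (by exact_mod_cast hγ)).add (hQ.smul (by exact_mod_cast hδ))) ?_
  have hc' : (γ : ℂ) * γ * c = 1 := by
    rw [mul_comm, ← sq]
    exact_mod_cast hc
  have hd' : (δ : ℂ) * δ * d = 1 := by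
    rw [mul_comm, ← sq]
    exact_mod_cast hd
  simp only [mul_add, add_mul, Matrix.smul_mul, Matrix.mul_smul, hPP, hQQ, hPQ, hQP, smul_zero,
    add_zero, zero_add, smul_smul]
  rw [← h1]
  congr 1
  · rw [hc', one_smul]
  · rw [hd', one_smul]

end NegHalfPower

/-! ### Diagonalising off-diagonal block matrices -/

namespace SelfadjointOperatorSpace

variable {H : Type*} [NormedAddCommGroup H] [InnerProductSpace ℂ H] [CompleteSpace H]
variable {K : Type*} [NormedAddCommGroup K] [InnerProductSpace ℂ K] [CompleteSpace K]
variable {E : SelfadjointOperatorSpace H} {F : SelfadjointOperatorSpace K}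
variable {ι κ : Type} [Fintype ι] [DecidableEq ι] [Fintype κ] [DecidableEq κ]

/-- The normalised diagonal embedding `2^{-1/2} (1, 1)` of `ℂ^ι` into `ℂ^ι ⊕ ℂ^ι`. -/
noncomputable def diagIncl (ι : Type) [DecidableEq ι] : Matrix (ι ⊕ ι) ι ℂ :=
  Matrix.fromRows (((√2)⁻¹ : ℝ) • (1 : Matrix ι ι ℂ)) (((√2)⁻¹ : ℝ) • 1)

/-- The normalised antidiagonal embedding `2^{-1/2} (1, -1)` of `ℂ^ι` into `ℂ^ι ⊕ ℂ^ι`. -/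
noncomputable def antidiagIncl (ι : Type) [DecidableEq ι] : Matrix (ι ⊕ ι) ι ℂ :=
  Matrix.fromRows (((√2)⁻¹ : ℝ) • (1 : Matrix ι ι ℂ)) (-(((√2)⁻¹ : ℝ) • 1))

theorem inv_sqrt_two_mul_self : (√2)⁻¹ * (√2)⁻¹ = (1 / 2 : ℝ) := by
  rw [← mul_inv, Real.mul_self_sqrt (by norm_num), one_div]

theorem inv_sqrt_two_mul_self_complex : ((√2 : ℝ) : ℂ)⁻¹ * ((√2 : ℝ) : ℂ)⁻¹ = 1 / 2 := by
  rw [← Complex.ofReal_inv, ← Complex.ofReal_mul, inv_sqrt_two_mul_self]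
  norm_num

omit [Fintype ι] in
theorem diagIncl_conjTranspose : (diagIncl ι).conjTranspose =
    Matrix.fromCols (((√2)⁻¹ : ℝ) • (1 : Matrix ι ι ℂ)) (((√2)⁻¹ : ℝ) • 1) := by
  simp [diagIncl, Matrix.conjTranspose_fromRows_eq_fromCols_conjTranspose]

omit [Fintype ι] in
theorem antidiagIncl_conjTranspose : (antidiagIncl ι).conjTranspose =
    Matrix.fromCols (((√2)⁻¹ : ℝ) • (1 : Matrix ι ι ℂ)) (-(((√2)⁻¹ : ℝ) • 1)) := by
  simp [antidiagIncl, Matrix.conjTranspose_fromRows_eq_fromCols_conjTranspose]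

theorem diagIncl_isometry : (diagIncl ι).conjTranspose * diagIncl ι = 1 := by
  rw [diagIncl_conjTranspose, diagIncl, Matrix.fromCols_mul_fromRows]
  simp only [Matrix.smul_mul, Matrix.mul_smul, one_mul, smul_smul, inv_sqrt_two_mul_self,
    ← add_smul]
  norm_num

theorem antidiagIncl_isometry : (antidiagIncl ι).conjTranspose * antidiagIncl ι = 1 := by
  rw [antidiagIncl_conjTranspose, antidiagIncl, Matrix.fromCols_mul_fromRows]
  simp only [Matrix.smul_mul, Matrix.mul_smul, one_mul, smul_smul, inv_sqrt_two_mul_self,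
    neg_mul_neg, ← add_smul]
  norm_num

theorem diagIncl_orthogonal : (diagIncl ι).conjTranspose * antidiagIncl ι = 0 := by
  rw [diagIncl_conjTranspose, antidiagIncl, Matrix.fromCols_mul_fromRows, mul_neg, add_neg_cancel]

theorem antidiagIncl_orthogonal : (antidiagIncl ι).conjTranspose * diagIncl ι = 0 := by
  rw [antidiagIncl_conjTranspose, diagIncl, Matrix.fromCols_mul_fromRows, neg_mul, add_neg_cancel]

theorem diagIncl_mul_conjTranspose : diagIncl ι * (diagIncl ι).conjTranspose =
    Matrix.fromBlocks ((1 / 2 : ℂ) • (1 : Matrix ι ι ℂ)) ((1 / 2 : ℂ) • (1 : Matrix ι ι ℂ))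
      ((1 / 2 : ℂ) • (1 : Matrix ι ι ℂ)) ((1 / 2 : ℂ) • (1 : Matrix ι ι ℂ)) := by
  rw [diagIncl_conjTranspose, diagIncl, Matrix.fromRows_mul_fromCols]
  simp only [Matrix.smul_mul, Matrix.mul_smul, one_mul, smul_smul, ← Complex.coe_smul,
    Complex.ofReal_inv, inv_sqrt_two_mul_self_complex]

theorem antidiagIncl_mul_conjTranspose : antidiagIncl ι * (antidiagIncl ι).conjTranspose =
    Matrix.fromBlocks ((1 / 2 : ℂ) • (1 : Matrix ι ι ℂ)) (-((1 / 2 : ℂ) • (1 : Matrix ι ι ℂ)))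
      (-((1 / 2 : ℂ) • (1 : Matrix ι ι ℂ))) ((1 / 2 : ℂ) • (1 : Matrix ι ι ℂ)) := by
  rw [antidiagIncl_conjTranspose, antidiagIncl, Matrix.fromRows_mul_fromCols]
  simp only [Matrix.smul_mul, Matrix.mul_smul, one_mul, smul_smul, ← Complex.coe_smul,
    Complex.ofReal_inv, inv_sqrt_two_mul_self_complex, mul_neg, neg_mul, neg_neg]

theorem diagIncl_add_antidiagIncl : diagIncl ι * (diagIncl ι).conjTranspose +
    antidiagIncl ι * (antidiagIncl ι).conjTranspose = 1 := by
  rw [diagIncl_mul_conjTranspose, antidiagIncl_mul_conjTranspose, Matrix.fromBlocks_add,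
    add_neg_cancel, ← add_smul, ← Matrix.fromBlocks_one]
  norm_num

theorem norm_scalarOp_diagIncl_conjTranspose_le :
    ‖scalarOp H (diagIncl ι).conjTranspose‖ ≤ 1 :=
  norm_scalarOp_conjTranspose_le diagIncl_isometry

theorem rpow_neg_half_diag_add_antidiag {c d γ δ : ℝ} (hγ : 0 ≤ γ) (hδ : 0 ≤ δ)
    (hc : c * γ ^ 2 = 1) (hd : d * δ ^ 2 = 1) :
    ((c : ℂ) • (diagIncl ι * (diagIncl ι).conjTranspose) +
      (d : ℂ) • (antidiagIncl ι * (antidiagIncl ι).conjTranspose)) ^ (-(1 / 2) : ℝ) =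
    (γ : ℂ) • (diagIncl ι * (diagIncl ι).conjTranspose) +
      (δ : ℂ) • (antidiagIncl ι * (antidiagIncl ι).conjTranspose) := by
  refine Matrix.PosSemidef.rpow_neg_half_add (Matrix.posSemidef_self_mul_conjTranspose _)
    (Matrix.posSemidef_self_mul_conjTranspose _) ?_ ?_ ?_ ?_ diagIncl_add_antidiagIncl hγ hδ hc hd
  · rw [Matrix.mul_assoc, ← Matrix.mul_assoc _ (diagIncl ι), diagIncl_isometry, Matrix.one_mul]
  · rw [Matrix.mul_assoc, ← Matrix.mul_assoc _ (antidiagIncl ι), antidiagIncl_isometry,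
      Matrix.one_mul]
  · rw [Matrix.mul_assoc, ← Matrix.mul_assoc _ (antidiagIncl ι), diagIncl_orthogonal,
      Matrix.zero_mul, Matrix.mul_zero]
  · rw [Matrix.mul_assoc, ← Matrix.mul_assoc _ (diagIncl ι), antidiagIncl_orthogonal,
      Matrix.zero_mul, Matrix.mul_zero]

/-- The two terms have equal diagonal blocks `x/2` and opposite off-diagonal blocks `±x/2`. So the
off-diagonal block matrix of `x` is unitarily `x ⊕ -x`. -/
theorem Mat.conj_diagIncl_sub_conj_antidiagIncl (x : E.Mat ι) :
    conj (diagIncl ι) x - conj (antidiagIncl ι) x =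
      of (Matrix.fromBlocks 0 (Matrix.of (coeff x)) (Matrix.of (coeff x)) 0) := by
  have key : ∀ (c d : ℝ) (i j : ι),
      ∑ k, ∑ l, ((c • (1 : Matrix ι ι ℂ)) i k * star ((d • (1 : Matrix ι ι ℂ)) j l)) •
        coeff x k l = ((c * d : ℝ) : ℂ) • coeff x i j := fun c d i j => by
    rw [Finset.sum_eq_single i, Finset.sum_eq_single j]
    · simp
    · intro l _ hl
      rw [Matrix.smul_apply _ _ j l, Matrix.one_apply_ne hl.symm, smul_zero, star_zero, mul_zero,
        zero_smul]
    · simp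
    · intro k _ hk
      refine Finset.sum_eq_zero fun l _ => ?_
      rw [Matrix.smul_apply _ _ i k, Matrix.one_apply_ne hk.symm, smul_zero, zero_mul, zero_smul]
    · simp
  have hP : ((1 / 2 : ℝ) : ℂ) + ((1 / 2 : ℝ) : ℂ) = 1 := by norm_num
  refine ext_coeff fun i j => ?_
  rw [coeff_sub, coeff_conj, coeff_conj]
  refine Eq.trans ?_ (coeff_of _ i j).symm
  rcases i with i | i <;> rcases j with j | j <;>
    simp only [diagIncl, antidiagIncl, ← neg_smul, Matrix.fromRows_apply_inl,
      Matrix.fromRows_apply_inr, key, neg_mul, mul_neg, neg_neg, inv_sqrt_two_mul_self,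
      Complex.ofReal_neg, sub_self, Matrix.fromBlocks_apply₁₁, Matrix.fromBlocks_apply₁₂,
      Matrix.fromBlocks_apply₂₁, Matrix.fromBlocks_apply₂₂, Matrix.zero_apply, Matrix.of_apply]
  · refine (sub_smul _ _ (coeff x i j)).symm.trans ?_
    rw [sub_neg_eq_add, hP, one_smul]
  · refine (sub_smul _ _ (coeff x i j)).symm.trans ?_
    rw [sub_neg_eq_add, hP, one_smul]

/-- The cross terms vanish because the two isometries have orthogonal ranges; each coefficient
appears squared as it acts from both sides. -/
theorem compress_diag_add_antidiag (γ δ : ℝ) (x : E.Mat ι) :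
    compress ((γ : ℂ) • (diagIncl ι * (diagIncl ι).conjTranspose) +
      (δ : ℂ) • (antidiagIncl ι * (antidiagIncl ι).conjTranspose))
      (Mat.conj (diagIncl ι) x - Mat.conj (antidiagIncl ι) x) =
    Mat.conj (diagIncl ι) (γ ^ 2 • x) + Mat.conj (antidiagIncl ι) (-(δ ^ 2 • x)) := by
  rw [compress_eq_conj, map_sub, Mat.conj_conj, Mat.conj_conj]
  · simp only [Matrix.add_mul, Matrix.smul_mul, Matrix.mul_assoc, diagIncl_isometry,
      antidiagIncl_isometry, diagIncl_orthogonal, antidiagIncl_orthogonal, Matrix.mul_one,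
      Matrix.mul_zero, smul_zero, add_zero, zero_add, Mat.conj_real_smul, map_neg,
      Mat.conj_smul_real, ← sub_eq_add_neg]
  · simp [Matrix.IsHermitian, Matrix.conjTranspose_mul]

theorem Mat.subsingleton [IsEmpty ι] (x y : E.Mat ι) : x = y :=
  ext_coeff fun i => isEmptyElim i

theorem amp_star {θ : E →ₗ[ℂ] F} (hθ : ∀ x : E, θ (star x) = star (θ x)) (x : E.Mat ι) :
    amp θ ι (star x) = star (amp θ ι x) :=
  Mat.ext_coeff fun i j => by rw [coeff_amp, Mat.coeff_star, Mat.coeff_star, coeff_amp, hθ]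

/-! ### Reading the distance off the cones and norms of the unitisation -/

namespace Unitisation

/-- The element `(x, a 1)` of `M_ι(E^#)`. -/
noncomputable def ofMatScalar (x : E.Mat ι) (a : ℝ) : Matrix ι ι E.Unitisation :=
  Matrix.of fun i j => ((Mat.coeff x i j, if i = j then (a : ℂ) else 0) : E × ℂ)

theorem ofMatScalar_isHermitian {x : E.Mat ι} (hx : IsSelfAdjoint x) (a : ℝ) :
    (ofMatScalar x a).IsHermitian := by
  ext i j
  refine Prod.ext ?_ ?_
  · change star (Mat.coeff x j i) = Mat.coeff x i j
    rw [← Mat.coeff_star, hx.star_eq]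
  · change star (if j = i then (a : ℂ) else 0) = if i = j then (a : ℂ) else 0
    rcases eq_or_ne i j with h | h
    · simp [h]
    · simp [h, h.symm]

theorem opPart_ofMatScalar (x : E.Mat ι) (a : ℝ) : opPart (ofMatScalar x a) = x :=
  Mat.ext_coeff fun i j => Mat.coeff_of _ i j

theorem scalarPart_ofMatScalar (x : E.Mat ι) (a : ℝ) :
    scalarPart (ofMatScalar x a) = (a : ℂ) • 1 := by
  ext i j
  change (if i = j then (a : ℂ) else 0) = _
  simp [Matrix.one_apply]

theorem ofMatScalar_map (θ : E →ₗ[ℂ] F) (x : E.Mat ι) (a : ℝ) :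
    (ofMatScalar x a).map (map θ) = ofMatScalar (amp θ ι x) a := by
  ext i j
  refine Prod.ext ?_ rfl
  exact (coeff_amp θ x i j).symm

/-- For scalar part `t1` the compression is division by `t + ε`, so the cone condition says `Re φ(x)
≥ -(t + ε)` for all `ε > 0`, and duality applies. -/
theorem ofMatScalar_mem_posCone_iff {x : E.Mat ι} (hx : IsSelfAdjoint x) {t : ℝ} (ht : 0 ≤ t) :
    ofMatScalar x t ∈ posCone E ι ↔ Metric.infDist x (E.posCone ι) ≤ t := by
  have key : ∀ ε : ℝ, 0 < ε →
      compress ((scalarPart (ofMatScalar x t) + (ε : ℂ) • 1) ^ (-(1 / 2) : ℝ))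
        (opPart (ofMatScalar x t)) = (t + ε)⁻¹ • x := fun ε hε => by
    have hpos : 0 < t + ε := by linarith
    have hγ : (t + ε) * (√(t + ε))⁻¹ ^ 2 = 1 := by
      rw [inv_pow, Real.sq_sqrt hpos.le, mul_inv_cancel₀ hpos.ne']
    -- The two-projection formula with `P = 1` and `Q = 0`.
    have h := Matrix.PosSemidef.rpow_neg_half_add (κ := ι) Matrix.PosSemidef.one
      Matrix.PosSemidef.zero (mul_one 1) (mul_zero 0) (mul_zero 1) (zero_mul 1) (add_zero 1)
      (inv_nonneg.2 (Real.sqrt_nonneg (t + ε))) (inv_nonneg.2 (Real.sqrt_nonneg (t + ε))) hγ hγ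
    rw [smul_zero, smul_zero, add_zero, add_zero] at h
    rw [scalarPart_ofMatScalar, opPart_ofMatScalar, ← add_smul, ← Complex.ofReal_add, h,
      compress_eq_conj, Mat.conj_real_smul, Mat.conj_one, inv_pow, Real.sq_sqrt hpos.le]
    simp [Matrix.IsHermitian]
  have hre : ∀ (c : ℝ) (φ : E.Mat ι →ₗ[ℂ] ℂ), (φ (c • x)).re = c * (φ x).re := fun c φ => by
    rw [← Complex.coe_smul, map_smul]
    simp
  rw [infDist_posCone_le_iff hx]
  constructor
  · intro h φ hφ
    refine le_of_forall_pos_le_add fun ε hε => ?_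
    have h1 := h.2.2 ε hε φ hφ
    rw [key ε hε, hre, ← div_eq_inv_mul, le_div_iff₀ (by linarith)] at h1
    linarith
  · intro h
    refine ⟨ofMatScalar_isHermitian hx t, ?_, fun ε hε φ hφ => ?_⟩
    · rw [scalarPart_ofMatScalar]
      exact Matrix.PosSemidef.one.smul (by exact_mod_cast ht)
    · rw [key ε hε, hre, ← div_eq_inv_mul, le_div_iff₀ (by linarith)]
      linarith [h φ hφ]

/-- The block matrix `[[t, X], [X^*, t]]` that defines the norm of `M_ι(E^#)`. -/
noncomputable def normBlock (X : Matrix ι ι E.Unitisation) (t : ℝ) :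
    Matrix (ι ⊕ ι) (ι ⊕ ι) E.Unitisation :=
  Matrix.fromBlocks (Matrix.diagonal fun _ => (t : ℂ) • unit E) X
    X.conjTranspose (Matrix.diagonal fun _ => (t : ℂ) • unit E)

theorem star_smul_unit (t : ℝ) : star ((t : ℂ) • unit E) = (t : ℂ) • unit E := by
  refine Prod.ext ?_ ?_
  · change star ((t : ℂ) • (0 : E)) = (t : ℂ) • (0 : E)
    rw [smul_zero, star_zero]
  · change star ((t : ℂ) * 1) = (t : ℂ) * 1
    simp

omit [Fintype ι] in
theorem normBlock_isHermitian (X : Matrix ι ι E.Unitisation) (t : ℝ) :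
    (normBlock X t).IsHermitian := by
  have hd : ((Matrix.diagonal fun _ : ι => (t : ℂ) • unit E)).IsHermitian := by
    refine Matrix.isHermitian_diagonal_of_self_adjoint _ ?_
    exact funext fun _ => star_smul_unit t
  exact hd.fromBlocks rfl hd

theorem opPart_normBlock_ofMatScalar {x : E.Mat ι} (hx : IsSelfAdjoint x) (a t : ℝ) :
    opPart (normBlock (ofMatScalar x a) t) =
      Mat.conj (diagIncl ι) x - Mat.conj (antidiagIncl ι) x := by
  rw [Mat.conj_diagIncl_sub_conj_antidiagIncl, normBlock, (ofMatScalar_isHermitian hx a).eq]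
  have hd : ∀ i j : ι, ((Matrix.diagonal fun _ : ι => (t : ℂ) • unit E) i j).1 = 0 :=
    fun i j => by
      rcases eq_or_ne i j with rfl | h
      · rw [Matrix.diagonal_apply_eq]
        exact smul_zero (t : ℂ)
      · rw [Matrix.diagonal_apply_ne _ h]
        rfl
  refine congrArg Mat.of (funext fun i => funext fun j => ?_)
  rcases i with i | i <;> rcases j with j | j
  · exact hd i j
  · rfl
  · rfl
  · exact hd i j

theorem scalarPart_normBlock_ofMatScalar {x : E.Mat ι} (hx : IsSelfAdjoint x) (a t : ℝ) :
    scalarPart (normBlock (ofMatScalar x a) t) =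
      ((t + a : ℝ) : ℂ) • (diagIncl ι * (diagIncl ι).conjTranspose) +
      ((t - a : ℝ) : ℂ) • (antidiagIncl ι * (antidiagIncl ι).conjTranspose) := by
  rw [diagIncl_mul_conjTranspose, antidiagIncl_mul_conjTranspose, normBlock,
    (ofMatScalar_isHermitian hx a).eq, Matrix.fromBlocks_smul, Matrix.fromBlocks_smul,
    Matrix.fromBlocks_add]
  have hd : ∀ i j : ι, ((Matrix.diagonal fun _ : ι => (t : ℂ) • unit E) i j).2 =
      (t : ℂ) * (1 : Matrix ι ι ℂ) i j :=
    fun i j => by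
      rcases eq_or_ne i j with rfl | h
      · rw [Matrix.diagonal_apply_eq, Matrix.one_apply_eq]
        rfl
      · rw [Matrix.diagonal_apply_ne _ h, Matrix.one_apply_ne h, mul_zero]
        rfl
  have ho : ∀ i j : ι, (ofMatScalar x a i j).2 = (a : ℂ) * (1 : Matrix ι ι ℂ) i j :=
    fun i j => (congrFun (congrFun (scalarPart_ofMatScalar x a) i) j)
  ext i j
  rcases i with i | i <;> rcases j with j | j
  · refine (hd i j).trans ?_
    simp
    ring
  · refine (ho i j).trans ?_
    simp
    ring
  · refine (ho i j).trans ?_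
    simp
    ring
  · refine (hd i j).trans ?_
    simp
    ring

/-- The scalar part has eigenvalue `t - a` on the diagonal and `t + a` on the antidiagonal copy, so
the compression is an orthogonal sum of multiples of `x` and `-x`. -/
theorem compress_normBlock_ofMatScalar {x : E.Mat ι} (hx : IsSelfAdjoint x) {a t : ℝ}
    (ha : 0 ≤ a) (hat : a ≤ t) {ε : ℝ} (hε : 0 < ε) :
    compress ((scalarPart (normBlock (ofMatScalar x (-a)) t) + (ε : ℂ) • 1) ^ (-(1 / 2) : ℝ))
        (opPart (normBlock (ofMatScalar x (-a)) t)) =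
      Mat.conj (diagIncl ι) ((t - a + ε)⁻¹ • x) +
        Mat.conj (antidiagIncl ι) (-((t + a + ε)⁻¹ • x)) := by
  have h1 : 0 < t - a + ε := by linarith
  have h2 : 0 < t + a + ε := by linarith
  have hγ : (t - a + ε) * (√(t - a + ε))⁻¹ ^ 2 = 1 := by
    rw [inv_pow, Real.sq_sqrt h1.le, mul_inv_cancel₀ h1.ne']
  have hδ : (t + a + ε) * (√(t + a + ε))⁻¹ ^ 2 = 1 := by
    rw [inv_pow, Real.sq_sqrt h2.le, mul_inv_cancel₀ h2.ne']
  have hs : scalarPart (normBlock (ofMatScalar x (-a)) t) + (ε : ℂ) • 1 =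
      ((t - a + ε : ℝ) : ℂ) • (diagIncl ι * (diagIncl ι).conjTranspose) +
      ((t + a + ε : ℝ) : ℂ) • (antidiagIncl ι * (antidiagIncl ι).conjTranspose) := by
    rw [scalarPart_normBlock_ofMatScalar hx, ← diagIncl_add_antidiagIncl, smul_add,
      add_add_add_comm, ← add_smul, ← add_smul, ← Complex.ofReal_add, ← Complex.ofReal_add,
      sub_neg_eq_add, ← sub_eq_add_neg]
  rw [hs, opPart_normBlock_ofMatScalar hx, rpow_neg_half_diag_add_antidiag
    (inv_nonneg.2 (Real.sqrt_nonneg _)) (inv_nonneg.2 (Real.sqrt_nonneg _)) hγ hδ,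
    compress_diag_add_antidiag, inv_pow, inv_pow, Real.sq_sqrt h1.le, Real.sq_sqrt h2.le]

/-- Correct only the diagonal corner by a cone element; the error is an orthogonal sum, whose norm
is at most `r` if both summands are. -/
theorem infDist_conj_diagIncl_add_conj_antidiagIncl_le {x y : E.Mat ι} {c r : ℝ} (hc : 0 < c)
    (hx : c * Metric.infDist x (E.posCone ι) < r) (hy : ‖y‖ ≤ r) :
    Metric.infDist (Mat.conj (diagIncl ι) (c • x) + Mat.conj (antidiagIncl ι) y)
      (E.posCone (ι ⊕ ι)) ≤ r := by
  obtain ⟨p, hp, hxp⟩ := (Metric.infDist_lt_iff (x := x) (s := E.posCone ι)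
    ⟨0, zero_mem_posConvexCone⟩).1 ((lt_div_iff₀' hc).2 hx)
  have hA : ‖c • x - c • p‖ ≤ r := by
    rw [← Mat.real_smul_sub, Mat.norm_real_smul hc.le, ← le_div_iff₀' hc]
    exact (dist_eq_norm x p).symm.trans_le hxp.le
  have hC : c • p ∈ E.posCone ι := (E.posConvexCone ι).smul_mem hc hp
  refine (Metric.infDist_le_dist_of_mem (Mat.conj_mem_posCone (diagIncl ι) hC)).trans ?_
  rw [dist_eq_norm, add_sub_right_comm, ← LinearMap.map_sub]
  exact Mat.norm_conj_add_conj_le diagIncl_isometry antidiagIncl_isometry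
    diagIncl_orthogonal diagIncl_add_antidiagIncl _ _ hA hy

/-- Since `‖x‖ ≤ a`, the corner `(-x, t + a)` is harmless and only `(x, t - a)` constrains `t`. -/
theorem normBlock_mem_posCone_iff [Nonempty ι] {x : E.Mat ι} (hx : IsSelfAdjoint x) {a : ℝ}
    (ha : ‖x‖ ≤ a) {t : ℝ} (ht : 0 ≤ t) :
    normBlock (ofMatScalar x (-a)) t ∈ posCone E (ι ⊕ ι) ↔
      a + Metric.infDist x (E.posCone ι) ≤ t := by
  have ha0 : 0 ≤ a := (norm_nonneg x).trans ha
  constructor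
  · intro h
    -- Test the scalar part on the vector `(e_i, e_i)`; this needs an index `i`.
    have hat : a ≤ t := by
      obtain ⟨i⟩ := ‹Nonempty ι›
      have h1 := h.2.1
      rw [scalarPart_normBlock_ofMatScalar hx, diagIncl_mul_conjTranspose,
        antidiagIncl_mul_conjTranspose, Matrix.fromBlocks_smul, Matrix.fromBlocks_smul,
        Matrix.fromBlocks_add] at h1
      have h2 := (h1.dotProduct_mulVec_nonneg
        (Sum.elim (Pi.single i 1) (Pi.single i 1) : ι ⊕ ι → ℂ))
      simp [Matrix.mulVec, dotProduct, Fintype.sum_sum_type, Pi.single_apply, Matrix.one_apply]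
        at h2
      ring_nf at h2
      have h3 := (Complex.le_def.1 h2).1
      simp at h3
      linarith
    suffices h : Metric.infDist x (E.posCone ι) ≤ t - a by linarith
    rw [infDist_posCone_le_iff hx]
    intro φ hφ
    refine le_of_forall_pos_le_add fun ε hε => ?_
    -- Pulling `φ` back along the diagonal corner kills the antidiagonal summand.
    have h1 := h.2.2 ε hε _ (hφ.comp_conj norm_scalarOp_diagIncl_conjTranspose_le)
    rw [compress_normBlock_ofMatScalar hx ha0 hat hε, LinearMap.comp_apply, map_add, Mat.conj_conj, Mat.conj_conj,
      diagIncl_isometry, diagIncl_orthogonal, Mat.conj_one, Mat.conj_zero, add_zero,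
      ← Complex.coe_smul, map_smul, smul_eq_mul, Complex.re_ofReal_mul, ← div_eq_inv_mul,
      le_div_iff₀ (by linarith)] at h1
    linarith
  · intro h
    have hat : a ≤ t := by
      linarith [Metric.infDist_nonneg (x := x) (s := E.posCone ι)]
    refine ⟨normBlock_isHermitian _ _, ?_, fun ε hε => ?_⟩
    · rw [scalarPart_normBlock_ofMatScalar hx]
      refine ((Matrix.posSemidef_self_mul_conjTranspose _).smul ?_).add
        ((Matrix.posSemidef_self_mul_conjTranspose _).smul ?_)
      · exact Complex.zero_le_real.2 (by linarith)
      · exact Complex.zero_le_real.2 (by linarith)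
    · rw [compress_normBlock_ofMatScalar hx ha0 hat hε]
      have h1 : 0 < t - a + ε := by linarith
      have h2 : 0 < t + a + ε := by linarith
      -- By duality it suffices that the compressed element is within distance 1 of the cone; `ε >
      -- 0` gives the strict inequality in the diagonal corner.
      refine (infDist_posCone_le_iff ?_ 1).1 ?_
      · rw [IsSelfAdjoint, star_add, ← Mat.conj_star, ← Mat.conj_star, star_neg]
        simp only [← Complex.coe_smul, star_smul, hx.star_eq, Complex.star_def,
          Complex.conj_ofReal]
      · refine infDist_conj_diagIncl_add_conj_antidiagIncl_le (inv_pos.2 h1) ?_ ?_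
        · rw [inv_mul_lt_one₀ h1]
          linarith
        · rw [norm_neg, Mat.norm_real_smul (inv_pos.2 h2).le, inv_mul_le_one₀ h2]
          linarith

theorem matNorm_ofMatScalar {n : ℕ} [Nonempty (Fin n)] {x : E.Mat (Fin n)} (hx : IsSelfAdjoint x)
    {a : ℝ} (ha : ‖x‖ ≤ a) :
    matNorm (ofMatScalar x (-a)) = a + Metric.infDist x (E.posCone (Fin n)) := by
  have h0 : 0 ≤ a + Metric.infDist x (E.posCone (Fin n)) :=
    add_nonneg ((norm_nonneg x).trans ha) Metric.infDist_nonneg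
  have h : {t : ℝ | 0 ≤ t ∧ normBlock (ofMatScalar x (-a)) t ∈ posCone E (Fin n ⊕ Fin n)} =
      Set.Ici (a + Metric.infDist x (E.posCone (Fin n))) := by
    ext t
    refine ⟨fun ht => (normBlock_mem_posCone_iff hx ha ht.1).1 ht.2, fun ht => ?_⟩
    exact ⟨h0.trans ht, (normBlock_mem_posCone_iff hx ha (h0.trans ht)).2 ht⟩
  change sInf {t : ℝ | 0 ≤ t ∧ normBlock (ofMatScalar x (-a)) t ∈ _} = _
  rw [h, csInf_Ici]

theorem map_star {θ : E →ₗ[ℂ] F} (hθ : ∀ x : E, θ (star x) = star (θ x)) (X : E.Unitisation) :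
    map θ (star X) = star (map θ X) :=
  Prod.ext (hθ X.1) rfl

theorem map_unit (θ : E →ₗ[ℂ] F) : map θ (unit E) = unit F :=
  Prod.ext (map_zero θ) rfl

theorem map_injective {θ : E →ₗ[ℂ] F} (hθ : Function.Injective θ) :
    Function.Injective (map θ) := fun _ _ h =>
  Prod.ext (hθ (congrArg (fun Z : F.Unitisation => Z.1) h))
    (congrArg (fun Z : F.Unitisation => Z.2) h)

theorem opPart_map (θ : E →ₗ[ℂ] F) (X : Matrix ι ι E.Unitisation) :
    opPart (X.map (map θ)) = amp θ ι (opPart X) :=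
  Mat.ext_coeff fun i j => by
    rw [coeff_amp, opPart, opPart, Mat.coeff_of, Mat.coeff_of]
    rfl

/-- Functionals on `M_ι(F)` restrict to `M_ι(E)` and those on `M_ι(E)` extend, so both cone
conditions test the same values; the scalar parts agree. -/
theorem map_mem_posCone_iff {θ : E →ₗ[ℂ] F} (hord : IsCompleteOrderEmbedding θ)
    (hamp : ∀ ψ : F.Mat ι →ₗ[ℂ] ℂ, IsCCP ψ → IsCCP (ψ ∘ₗ amp θ ι))
    (hext : ∀ φ : E.Mat ι →ₗ[ℂ] ℂ, IsCCP φ →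
      ∃ ψ : F.Mat ι →ₗ[ℂ] ℂ, IsCCP ψ ∧ ∀ x, ψ (amp θ ι x) = φ x)
    (X : Matrix ι ι E.Unitisation) :
    X.map (map θ) ∈ posCone F ι ↔ X ∈ posCone E ι := by
  refine and_congr ?_ (and_congr Iff.rfl (forall₂_congr fun ε hε => ?_))
  · rw [Matrix.IsHermitian, Matrix.IsHermitian,
      ← Matrix.conjTranspose_map _ (fun Y => map_star hord.1.1 Y)]
    exact (Matrix.map_injective (map_injective hord.2.1)).eq_iff
  · have hs : scalarPart (X.map (map θ)) = scalarPart X := rfl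
    rw [hs, opPart_map, ← amp_compress]
    refine ⟨fun h φ hφ => ?_, fun h ψ hψ => h _ (hamp ψ hψ)⟩
    obtain ⟨ψ, hψ, hψφ⟩ := hext φ hφ
    rw [← hψφ]
    exact h ψ hψ

omit [Fintype ι] in
theorem normBlock_map {θ : E →ₗ[ℂ] F} (hθ : ∀ x : E, θ (star x) = star (θ x))
    (X : Matrix ι ι E.Unitisation) (t : ℝ) :
    normBlock (X.map (map θ)) t = (normBlock X t).map (map θ) := by
  rw [normBlock, normBlock, Matrix.fromBlocks_map, Matrix.conjTranspose_map _ (map_star hθ),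
    Matrix.diagonal_map (map_zero _)]
  simp only [map_smul, map_unit]

end Unitisation

/-! ### From `Fin n` to arbitrary finite index sets -/

/-- The permutation matrix of a bijection between index sets. -/
noncomputable def reindexMatrix (e : ι ≃ κ) : Matrix κ ι ℂ :=
  (1 : Matrix ι ι ℂ).submatrix e.symm id

omit [DecidableEq κ] in
theorem reindexMatrix_conjTranspose_mul (e : ι ≃ κ) :
    (reindexMatrix e).conjTranspose * reindexMatrix e = 1 := by
  rw [reindexMatrix, Matrix.conjTranspose_submatrix, Matrix.submatrix_mul_equiv]
  simp

theorem IsCCP.comp_conj_reindexMatrix {φ : E.Mat κ →ₗ[ℂ] ℂ} (hφ : IsCCP φ) (e : ι ≃ κ) :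
    IsCCP (φ ∘ₗ Mat.conj (reindexMatrix e)) :=
  hφ.comp_conj (norm_scalarOp_le (reindexMatrix_conjTranspose_mul e))

theorem IsCCP.comp_conj_reindexMatrix_conjTranspose {φ : E.Mat ι →ₗ[ℂ] ℂ} (hφ : IsCCP φ)
    (e : ι ≃ κ) : IsCCP (φ ∘ₗ Mat.conj (reindexMatrix e).conjTranspose) :=
  hφ.comp_conj (norm_scalarOp_conjTranspose_le (reindexMatrix_conjTranspose_mul e))

theorem Mat.conj_reindexMatrix_conj (e : ι ≃ κ) (x : E.Mat ι) :
    conj (reindexMatrix e).conjTranspose (conj (reindexMatrix e) x) = x := by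
  rw [conj_conj, reindexMatrix_conjTranspose_mul, conj_one]

theorem IsCCP.comp_amp_fin {θ : E →ₗ[ℂ] F} (hiso : IsCompletelyIsometric θ)
    (hord : IsCompletelyPositive θ) {n : ℕ} {ψ : F.Mat (Fin n) →ₗ[ℂ] ℂ} (hψ : IsCCP ψ) :
    IsCCP (ψ ∘ₗ amp θ (Fin n)) :=
  ⟨fun x => (hψ.1 _).trans_eq (hiso n x),
    fun x => by simp only [LinearMap.comp_apply, amp_star hord.1, hψ.2.1],
    fun x hx => hψ.2.2 _ (hord.2 n x hx)⟩

/-- The norm on `M_n(E^#)` uses the index set `Fin n ⊕ Fin n`, whereas the hypotheses on `θ` concern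
`Fin n`; conjugation by permutation matrices, which commutes with `amp`, bridges the two. -/
theorem IsCCP.comp_amp {θ : E →ₗ[ℂ] F} (hiso : IsCompletelyIsometric θ)
    (hord : IsCompletelyPositive θ) {ψ : F.Mat ι →ₗ[ℂ] ℂ} (hψ : IsCCP ψ) :
    IsCCP (ψ ∘ₗ amp θ ι) := by
  let e := Fintype.equivFin ι
  have h := ((hψ.comp_conj_reindexMatrix_conjTranspose e).comp_amp_fin hiso
    hord).comp_conj_reindexMatrix e
  convert h using 1
  ext x
  simp only [LinearMap.comp_apply, amp_conj, Mat.conj_reindexMatrix_conj]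

theorem ExtendsCCPFunctionals.exists_extension {θ : E →ₗ[ℂ] F} (h : ExtendsCCPFunctionals θ)
    {φ : E.Mat ι →ₗ[ℂ] ℂ} (hφ : IsCCP φ) :
    ∃ ψ : F.Mat ι →ₗ[ℂ] ℂ, IsCCP ψ ∧ ∀ x, ψ (amp θ ι x) = φ x := by
  let e := Fintype.equivFin ι
  obtain ⟨ψ, hψ, hψφ⟩ := h _ _ (hφ.comp_conj_reindexMatrix_conjTranspose e)
  refine ⟨_, hψ.comp_conj_reindexMatrix e, fun x => ?_⟩
  rw [LinearMap.comp_apply, ← amp_conj, hψφ, LinearMap.comp_apply, Mat.conj_reindexMatrix_conj]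

theorem isSelfAdjoint_amp {θ : E →ₗ[ℂ] F} (hθ : ∀ x : E, θ (star x) = star (θ x)) {x : E.Mat ι}
    (hx : IsSelfAdjoint x) : IsSelfAdjoint (amp θ ι x) := by
  rw [IsSelfAdjoint, ← amp_star hθ, hx.star_eq]

theorem realPart_amp {θ : E →ₗ[ℂ] F} (hθ : ∀ x : E, θ (star x) = star (θ x)) (x : E.Mat ι) :
    (realPart (amp θ ι x) : F.Mat ι) = amp θ ι (realPart x : E.Mat ι) := by
  rw [realPart_apply_coe, realPart_apply_coe, ← amp_star hθ, ← map_add, ← Complex.coe_smul,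
    ← Complex.coe_smul, map_smul]

/-! ### The implications -/

variable {θ : E →ₗ[ℂ] F}

theorem IsEmbedding.isGaugeMaximalIsometry (h : IsEmbedding θ) : IsGaugeMaximalIsometry θ := by
  refine ⟨h.1, h.2.1, fun n x hx => ?_⟩
  have hx' : IsSelfAdjoint (amp θ (Fin n) x) := isSelfAdjoint_amp h.2.1.1.1 hx
  have key : ∀ t : ℝ, 0 ≤ t → (Metric.infDist x (E.posCone (Fin n)) ≤ t ↔
      Metric.infDist (amp θ (Fin n) x) (F.posCone (Fin n)) ≤ t) := fun t ht => by
    rw [← Unitisation.ofMatScalar_mem_posCone_iff hx ht,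
      ← Unitisation.ofMatScalar_mem_posCone_iff hx' ht, ← Unitisation.ofMatScalar_map]
    exact ⟨h.2.2.2.1.2 n _, h.2.2.2.2.2 n _⟩
  exact le_antisymm ((key _ Metric.infDist_nonneg).2 le_rfl)
    ((key _ Metric.infDist_nonneg).1 le_rfl)

theorem IsGaugeMaximalIsometry.of_isCompletelyIsometric_map (hiso : IsCompletelyIsometric θ)
    (hord : IsCompleteOrderEmbedding θ)
    (h : Unitisation.IsCompletelyIsometric (Unitisation.map θ)) : IsGaugeMaximalIsometry θ := by
  refine ⟨hiso, hord, fun n x hx => ?_⟩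
  -- For `n = 0` the norm on the unitisation carries no information, but both distances are 0.
  rcases isEmpty_or_nonempty (Fin n) with hn | hn
  · rw [Mat.subsingleton x 0, map_zero]
    exact (Metric.infDist_zero_of_mem (zero_mem_posConvexCone (E := E))).trans
      (Metric.infDist_zero_of_mem (zero_mem_posConvexCone (E := F))).symm
  · have hx' : IsSelfAdjoint (amp θ (Fin n) x) := isSelfAdjoint_amp hord.1.1 hx
    -- The choice `a = ‖x‖` is admissible on both sides because `θ` is completely isometric.
    have h1 := h n (Unitisation.ofMatScalar x (-‖x‖))
    rw [Unitisation.ofMatScalar_map, Unitisation.matNorm_ofMatScalar hx le_rfl,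
      Unitisation.matNorm_ofMatScalar hx' (hiso n x).le] at h1
    exact (add_left_cancel h1).symm

theorem IsGaugeMaximalIsometry.extendsCCPFunctionals (h : IsGaugeMaximalIsometry θ) :
    ExtendsCCPFunctionals θ := fun n φ hφ => by
  have hinj : Function.Injective (amp θ (Fin n)) :=
    (injective_iff_map_eq_zero _).2 fun x hx => by
      rw [← norm_eq_zero, ← h.1 n x, hx, norm_zero]
  refine IsContractivePositive.exists_extension (C := F.posConvexCone (Fin n))
    (D := E.posConvexCone (Fin n)) zero_mem_posConvexCone isSelfAdjoint_of_mem_posConvexCone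
    ⟨0, zero_mem_posConvexCone⟩ (amp θ (Fin n)) hinj (fun x => ?_) hφ
  -- As `θ` commutes with the involution, equality of distances on selfadjoint elements gives
  -- equality of the gauges everywhere.
  rw [realPartDist, realPartDist, realPart_amp h.2.1.1.1]
  exact (h.2.2 n _ (realPart x).2).le

theorem ExtendsCCPFunctionals.map_mem_posCone_iff (h : ExtendsCCPFunctionals θ)
    (hiso : IsCompletelyIsometric θ) (hord : IsCompleteOrderEmbedding θ)
    (X : Matrix ι ι E.Unitisation) :
    X.map (Unitisation.map θ) ∈ Unitisation.posCone F ι ↔ X ∈ Unitisation.posCone E ι :=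
  Unitisation.map_mem_posCone_iff hord (fun _ hψ => hψ.comp_amp hiso hord.1)
    (fun _ hφ => h.exists_extension hφ) X

theorem ExtendsCCPFunctionals.isEmbedding (h : ExtendsCCPFunctionals θ)
    (hiso : IsCompletelyIsometric θ) (hord : IsCompleteOrderEmbedding θ) : IsEmbedding θ :=
  ⟨hiso, hord, Unitisation.map_unit θ,
    ⟨Unitisation.map_star hord.1.1, fun _ X => (h.map_mem_posCone_iff hiso hord X).2⟩,
    Unitisation.map_injective hord.2.1, fun _ X => (h.map_mem_posCone_iff hiso hord X).1⟩

theorem ExtendsCCPFunctionals.isCompletelyIsometric_map (h : ExtendsCCPFunctionals θ)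
    (hiso : IsCompletelyIsometric θ) (hord : IsCompleteOrderEmbedding θ) :
    Unitisation.IsCompletelyIsometric (Unitisation.map θ) := fun n X => by
  change sInf {t : ℝ | 0 ≤ t ∧ Unitisation.normBlock (X.map (Unitisation.map θ)) t ∈ _} =
    sInf {t : ℝ | 0 ≤ t ∧ Unitisation.normBlock X t ∈ _}
  simp only [Unitisation.normBlock_map hord.1.1, h.map_mem_posCone_iff hiso hord]

end SelfadjointOperatorSpace

theorem theorem3p3
    {H : Type*} [NormedAddCommGroup H] [InnerProductSpace ℂ H] [CompleteSpace H]
    {K : Type*} [NormedAddCommGroup K] [InnerProductSpace ℂ K] [CompleteSpace K]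
    (E : SelfadjointOperatorSpace H) (F : SelfadjointOperatorSpace K) (θ : E →ₗ[ℂ] F)
    (hiso : SelfadjointOperatorSpace.IsCompletelyIsometric θ)
    (hord : SelfadjointOperatorSpace.IsCompleteOrderEmbedding θ) :
    [SelfadjointOperatorSpace.IsEmbedding θ,
      SelfadjointOperatorSpace.Unitisation.IsCompletelyIsometric
        (SelfadjointOperatorSpace.Unitisation.map θ),
      SelfadjointOperatorSpace.ExtendsCCPFunctionals θ,
      SelfadjointOperatorSpace.IsGaugeMaximalIsometry θ].TFAE := by
  tfae_have 1 → 4 := fun h => h.isGaugeMaximalIsometry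
  tfae_have 2 → 4 := fun h =>
    SelfadjointOperatorSpace.IsGaugeMaximalIsometry.of_isCompletelyIsometric_map hiso hord h
  tfae_have 4 → 3 := fun h => h.extendsCCPFunctionals
  tfae_have 3 → 1 := fun h => h.isEmbedding hiso hord
  tfae_have 3 → 2 := fun h => h.isCompletelyIsometric_map hiso hord
  tfae_finish
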